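/- Let $G\subset\mathrm{GL}(n,\mathbb R)$ be a solvable real algebraic group, meaning: $G$ is a connected Lie subgroup, solvable as a group, and the connected subgroup $G^{\mathbb C}$ of $\mathrm{GL}(n,\mathbb C)$ with Lie algebra $\mathrm{Lie}(G)+\sqrt{-1}\,\mathrm{Lie}(G)$ is an algebraic subgroup of $\mathrm{GL}(n,\mathbb C)$. For a set $S$ of simple roots $\alpha_k=\varepsilon_k-\varepsilon_{k+1}$ ($1\le k\le n-1$) let $P_S\subset\mathrm{GL}(n,\mathbb R)$ be the standard real parabolic subgroup of invertible block upper triangular matrices, where $k$ and $k+1$ lie in the same block if and only if $\alpha_k\in S$. If the roots in $S$ are mutually orthogonal, all blocks have size $1$ or $2$. Then there are $a\in\mathrm{GL}(n,\mathbb R)$ and a set $S$ of mutually orthogonal simple roots such that $aGa^{-1}$ is contained in the group $B$ of all matrices in $P_S$ whose $1\times1$ diagonal blocks are positive and whose $2\times2$ diagonal blocks have the form $\begin{pmatrix}x&y\\-y&x\end{pmatrix}$ with $x^2+y^2\neq0$. Moreover $B=C\ltimes U$, where: 1. $U$, the set of unipotent elements of $B$, is the unipotent radical of $P_S$ (its largest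 connected normal unipotent algebraic subgroup); 2. $C$, the group of block diagonal matrices in $B$, consists of semisimple elements and is a Cartan subgroup of $P_S$, that is, a connected Lie subgroup of $P_S$ whose complexification $C^{\mathbb C}$ (the connected subgroup of $\mathrm{GL}(n,\mathbb C)$ with Lie algebra $\mathrm{Lie}(C)+\sqrt{-1}\,\mathrm{Lie}(C)$) is a maximal algebraic torus of $P_S^{\mathbb C}$, the connected subgroup of $\mathrm{GL}(n,\mathbb C)$ with Lie algebra $\mathrm{Lie}(P_S)+\sqrt{-1}\,\mathrm{Lie}(P_S)$. -/

import Mathlib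

open Matrix

noncomputable section

namespace RealAlg

variable {n : ℕ}

/-! ### Algebraic subgroups, Lie algebras and complexification -/

/-- A subgroup of `GL(n, K)` is Zariski closed (algebraic) if it is cut out inside `GL(n, K)` by
polynomials in the matrix entries. (Equations involving `1 / det` can be cleared of
denominators.) -/
def IsZariskiClosed {K : Type} [Field K] (H : Subgroup (GL (Fin n) K)) : Prop :=
  ∃ I : Set (MvPolynomial (Fin n × Fin n) K), ∀ g : GL (Fin n) K,
    g ∈ H ↔ ∀ p ∈ I, MvPolynomial.eval (fun ij => (g : Matrix (Fin n) (Fin n) K) ij.1 ij.2) p = 0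

/-- The Lie algebra of a Lie subgroup `H` of `GL(n, ℝ)`: all `X` whose one-parameter group
`t ↦ exp (t X)` lies in `H`. -/
def lieAlg (H : Subgroup (GL (Fin n) ℝ)) : Set (Matrix (Fin n) (Fin n) ℝ) :=
  {X | ∀ t : ℝ, ∃ h ∈ H, (h : Matrix (Fin n) (Fin n) ℝ) = NormedSpace.exp (t • X)}

/-- `H` is a connected Lie subgroup of `GL(n, ℝ)`: it is generated by the exponentials of the
elements of its Lie algebra. -/
def IsConnectedLie (H : Subgroup (GL (Fin n) ℝ)) : Prop :=
  H = Subgroup.closure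
    {h : GL (Fin n) ℝ | ∃ X ∈ lieAlg H, (h : Matrix (Fin n) (Fin n) ℝ) = NormedSpace.exp X}

/-- The complexification of `H`: the connected subgroup of `GL(n, ℂ)` with Lie algebra
`Lie(H) + √-1 Lie(H)`, that is, the group generated by the exponentials of the elements of
the latter. It only depends on the identity component of `H`. -/
def complexification (H : Subgroup (GL (Fin n) ℝ)) : Subgroup (GL (Fin n) ℂ) :=
  Subgroup.closure
    {h : GL (Fin n) ℂ | ∃ X ∈ lieAlg H, ∃ Y ∈ lieAlg H,
      (h : Matrix (Fin n) (Fin n) ℂ) =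
        NormedSpace.exp (X.map Complex.ofReal + Complex.I • Y.map Complex.ofReal)}

/-- A real algebraic group: a connected Lie subgroup of `GL(n, ℝ)` whose complexification is an
algebraic subgroup of `GL(n, ℂ)`. -/
def IsRealAlgebraic (H : Subgroup (GL (Fin n) ℝ)) : Prop :=
  IsConnectedLie H ∧ IsZariskiClosed (complexification H)

/-! ### Semisimple and unipotent elements, tori, Cartan subgroups, unipotent radicals -/

/-- A real matrix is semisimple if it is diagonalizable over `ℂ`. -/
def IsSemisimpleElt (g : GL (Fin n) ℝ) : Prop :=
  ∃ p : GL (Fin n) ℂ,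
    ((p : Matrix (Fin n) (Fin n) ℂ) * (g : Matrix (Fin n) (Fin n) ℝ).map Complex.ofReal *
      ((p⁻¹ : GL (Fin n) ℂ) : Matrix (Fin n) (Fin n) ℂ)).IsDiag

def IsUnipotentElt (g : GL (Fin n) ℝ) : Prop :=
  IsNilpotent ((g : Matrix (Fin n) (Fin n) ℝ) - 1)

/-- An algebraic torus in `GL(n, ℂ)`: a connected diagonalizable algebraic subgroup. -/
def IsTorus (T : Subgroup (GL (Fin n) ℂ)) : Prop :=
  IsZariskiClosed T ∧ IsConnected (T : Set (GL (Fin n) ℂ)) ∧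
    ∃ p : GL (Fin n) ℂ, ∀ t ∈ T, ((p * t * p⁻¹ : GL (Fin n) ℂ) : Matrix (Fin n) (Fin n) ℂ).IsDiag

/-- `C` is a Cartan subgroup of `P`: a connected Lie subgroup of `P` whose complexification is
a maximal algebraic torus of the complexification of `P`. -/
def IsCartanSubgroup (C P : Subgroup (GL (Fin n) ℝ)) : Prop :=
  C ≤ P ∧ IsConnectedLie C ∧
    Maximal (fun T => IsTorus T ∧ T ≤ complexification P) (complexification C)

/-- `U` is the unipotent radical of `P`: the largest connected normal unipotent algebraic
subgroup of `P`. -/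
def IsUnipotentRadical (U P : Subgroup (GL (Fin n) ℝ)) : Prop :=
  IsGreatest
    {N : Subgroup (GL (Fin n) ℝ) | N ≤ P ∧ (N.subgroupOf P).Normal ∧ IsZariskiClosed N ∧
      IsConnected (N : Set (GL (Fin n) ℝ)) ∧ ∀ g ∈ N, IsUnipotentElt g} U

/-! ### Standard parabolic subgroups of `GL(n, ℝ)` -/

/-- The first index of the `k`-th simple root of type `A_{n-1}`. -/
def lo (k : Fin (n - 1)) : Fin n := ⟨k, by omega⟩

/-- The second index of the `k`-th simple root of type `A_{n-1}`. -/
def hi (k : Fin (n - 1)) : Fin n := ⟨k + 1, by omega⟩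

/-- The simple root `ε_k - ε_{k+1}` of type `A_{n-1}`. -/
def simpleRoot (k : Fin (n - 1)) : Fin n → ℝ :=
  Pi.single (lo k) 1 - Pi.single (hi k) 1

/-- The simple roots indexed by `S` are mutually orthogonal. -/
def MutuallyOrthogonal (S : Finset (Fin (n - 1))) : Prop :=
  ∀ k ∈ S, ∀ l ∈ S, k ≠ l → simpleRoot k ⬝ᵥ simpleRoot l = 0

/-- The block containing the index `i`, for the partition of `{0, …, n-1}` into intervals in which
`k` and `k + 1` lie in the same block exactly when the `k`-th simple root is in `S`. -/
def blockIdx (S : Finset (Fin (n - 1))) (i : Fin n) : ℕ :=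
  (Finset.univ.filter fun k : Fin (n - 1) => (k : ℕ) < i ∧ k ∉ S).card

/-- The standard real parabolic subgroup of `GL(n, ℝ)` given by a set `S` of simple roots:
the invertible block upper triangular matrices for the partition determined by `S`. -/
def stdParabolic (S : Finset (Fin (n - 1))) : Subgroup (GL (Fin n) ℝ) where
  carrier := {g | BlockTriangular (g : Matrix (Fin n) (Fin n) ℝ) (blockIdx S)}
  one_mem' := by
    simpa using (blockTriangular_one : BlockTriangular (1 : Matrix (Fin n) (Fin n) ℝ) (blockIdx S))
  mul_mem' := by
    intro a b ha hb
    simpa using BlockTriangular.mul ha hb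
  inv_mem' := by
    intro a ha
    have : Invertible (a : Matrix (Fin n) (Fin n) ℝ) := a.isUnit.invertible
    have h := blockTriangular_inv_of_blockTriangular (show BlockTriangular
      (a : Matrix (Fin n) (Fin n) ℝ) (blockIdx S) from ha)
    simpa using h

/-- For mutually orthogonal `S`: the `1 × 1` diagonal blocks are positive and each `2 × 2` diagonal
block is of the form `(x, y; -y, x)`. (For an invertible block triangular matrix `x² + y² ≠ 0`
is automatic.) -/
def HasRotationScalingBlocks (S : Finset (Fin (n - 1))) (g : GL (Fin n) ℝ) : Prop :=
  (∀ i : Fin n, (∀ k ∈ S, i ≠ lo k ∧ i ≠ hi k) → 0 < (g : Matrix (Fin n) (Fin n) ℝ) i i) ∧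
  ∀ k ∈ S, (g : Matrix (Fin n) (Fin n) ℝ) (hi k) (hi k) = (g : Matrix (Fin n) (Fin n) ℝ) (lo k) (lo k) ∧
    (g : Matrix (Fin n) (Fin n) ℝ) (hi k) (lo k) = -(g : Matrix (Fin n) (Fin n) ℝ) (lo k) (hi k)

/-- `g` is block diagonal for the partition determined by `S`. -/
def IsBlockDiag (S : Finset (Fin (n - 1))) (g : GL (Fin n) ℝ) : Prop :=
  ∀ i j : Fin n, blockIdx S i ≠ blockIdx S j → (g : Matrix (Fin n) (Fin n) ℝ) i j = 0

end RealAlg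

end

/-! ### Lie–Kolchin for connected solvable topological groups. -/

section LieKolchin

open Module
open scoped commutatorElement

/-! Conjugation into `B`. A group generated by one-parameter subgroups is connected, so Lie–Kolchin
gives `G` a common eigenvector `v = u + iw` in complex n-space (`exists_common_eigenvector`). The
real span of `u` and `w` is a `G`-stable line or plane. On a line the character is continuous and
never zero, hence positive; on a plane an eigenvalue `x + iy` acts as the block `(x, y; -y, x)`.
Induction on the quotient yields an adapted basis (`exists_basis_isRotTriangular`). The starting
positions of the planes are never consecutive, which makes the corresponding simple roots mutually
orthogonal.

Structure of `B`. Let `σ` swap the two indices of each `2 × 2` block. The vectors `e_j + i e_{σ j}`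
(`e_j` alone if `σ j = j`) diagonalize all of `C` at once, so products and exponentials in `C`
become pointwise operations on eigenvalue vectors `z` with `z ∘ σ` conjugate to `z`. Every complex
vector has the form `x + iy` with `x` and `y` of this kind. The complexification of `C` is therefore
a full conjugate of the diagonal torus, and it is maximal because it contains an element with
distinct eigenvalues.

Taking the block diagonal part is multiplicative on `P_S` (`diagPart_mul`). Its kernel is `U`, and
`B` is the preimage of `C`, which splits `B`. A unipotent element of `C` is diagonalizable, hence
trivial, so `U` is the set of unipotents of `B`. A normal unipotent subgroup of `P_S` lies in `U`:
if `A` is a `2 × 2` block of one of its elements and `J` a quarter turn, then `A` and `A * (J * A *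
J⁻¹)` are both unipotent, and their traces force `A = 1` (`le_blockUnipotent`). -/

theorem isPreconnected_closure_of_forall {Γ : Type*} [Group Γ] [TopologicalSpace Γ]
    [IsTopologicalGroup Γ] {s : Set Γ}
    (hs : ∀ x ∈ s, ∃ t ⊆ (Subgroup.closure s : Set Γ), 1 ∈ t ∧ x ∈ t ∧ IsPreconnected t) :
    IsPreconnected (Subgroup.closure s : Set Γ) := by
  refine isPreconnected_of_forall 1 fun y hy => ?_
  induction hy using Subgroup.closure_induction with
  | mem x hx => exact hs x hx
  | one => exact ⟨{1}, by simp [one_mem], rfl, rfl, isPreconnected_singleton⟩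
  | mul x y hx hy ihx ihy =>
    obtain ⟨t, ht, h1, hxt, hc⟩ := ihx
    obtain ⟨u, hu, hu1, hyu, hcu⟩ := ihy
    refine ⟨t ∪ (fun z => x * z) '' u, ?_, Or.inl h1, Or.inr ⟨y, hyu, rfl⟩, ?_⟩
    · rintro z (hz | ⟨w, hw, rfl⟩)
      · exact ht hz
      · exact mul_mem hx (hu hw)
    · exact hc.union x hxt ⟨1, hu1, mul_one x⟩
        (hcu.image _ (continuous_const_mul x).continuousOn)
  | inv x hx ih =>
    obtain ⟨t, ht, h1, hxt, hc⟩ := ih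
    refine ⟨(fun z => z⁻¹) '' t, ?_, ⟨1, h1, inv_one⟩, ⟨x, hxt, rfl⟩,
      hc.image _ continuous_inv.continuousOn⟩
    rintro z ⟨w, hw, rfl⟩
    exact inv_mem (ht hw)

/-- Commutators of a connected subgroup form the continuous image of a connected product, and this
image contains 1; hence they generate a connected group. -/
theorem isPreconnected_derivedSeries (Γ : Type*) [Group Γ] [TopologicalSpace Γ]
    [IsTopologicalGroup Γ] [PreconnectedSpace Γ] (k : ℕ) :
    IsPreconnected (derivedSeries Γ k : Set Γ) := by
  induction k with
  | zero => simpa using isPreconnected_univ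
  | succ k ih =>
    rw [derivedSeries_succ, Subgroup.commutator_def]
    refine isPreconnected_closure_of_forall ?_
    rintro x ⟨a, ha, b, hb, rfl⟩
    refine ⟨(fun p : Γ × Γ => ⁅p.1, p.2⁆) ''
      ((derivedSeries Γ k : Set Γ) ×ˢ (derivedSeries Γ k : Set Γ)), ?_, ⟨(1, 1), ?_, by simp⟩,
      ⟨(a, b), ⟨ha, hb⟩, rfl⟩, (ih.prod ih).image _ ?_⟩
    · rintro _ ⟨p, hp, rfl⟩
      exact Subgroup.subset_closure ⟨p.1, hp.1, p.2, hp.2, rfl⟩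
    · exact ⟨one_mem _, one_mem _⟩
    · simp only [commutatorElement_def]
      fun_prop

/-- A pairwise commuting family of endomorphisms over an algebraically closed field has a common
eigenvector. -/
theorem exists_common_eigenvector_of_commute {K : Type*} [Field K] [IsAlgClosed K] {ι : Type*}
    {V : Type*} [AddCommGroup V] [Module K V] [FiniteDimensional K V] [Nontrivial V]
    (f : ι → End K V) (hf : ∀ i j, Commute (f i) (f j)) :
    ∃ v : V, v ≠ 0 ∧ ∀ i, ∃ c : K, f i v = c • v := by
  generalize hn : finrank K V = n
  induction n using Nat.strong_induction_on generalizing V with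
  | _ n ih =>
  by_cases h : ∀ i, ∃ c : K, ∀ v, f i v = c • v
  · obtain ⟨v, hv⟩ := exists_ne (0 : V)
    exact ⟨v, hv, fun i => (h i).imp fun c hc => hc v⟩
  · push Not at h
    obtain ⟨i, hi⟩ := h
    obtain ⟨c, hc⟩ := End.exists_eigenvalue (f i)
    set W := End.eigenspace (f i) c with hW
    have hmap : ∀ j, ∀ w ∈ W, f j w ∈ W := by
      intro j w hw
      rw [hW, End.mem_eigenspace_iff] at hw ⊢
      rw [← Module.End.mul_apply, (hf i j).eq, Module.End.mul_apply, hw, map_smul]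
    have hlt : finrank K W < n := by
      rw [← hn]
      refine Submodule.finrank_lt fun htop => ?_
      obtain ⟨v, hv⟩ := hi c
      exact hv (End.mem_eigenspace_iff.1 (by rw [← hW, htop]; trivial))
    have : Nontrivial W := Submodule.nontrivial_iff_ne_bot.2 hc
    obtain ⟨w, hw0, hw⟩ := ih _ hlt (fun j => (f j).restrict (hmap j)) (fun j k => by
      ext x
      exact LinearMap.congr_fun (hf j k).eq x) rfl
    refine ⟨w, by simpa using hw0, fun j => ?_⟩
    obtain ⟨c, hc⟩ := hw j
    exact ⟨c, congrArg Subtype.val hc⟩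

/-- The rigidity behind Lie–Kolchin: a finite T1 space is discrete. It is applied to eigenvalues of
a fixed operator and to roots of unity. -/
theorem IsPreconnected.eq_of_mapsTo_finite {X Y : Type*} [TopologicalSpace X] [TopologicalSpace Y]
    [T1Space Y] {s : Set X} (hs : IsPreconnected s) {φ : X → Y} (hφ : Continuous φ) {t : Set Y}
    (ht : t.Finite) (h : Set.MapsTo φ s t) {x y : X} (hx : x ∈ s) (hy : y ∈ s) : φ x = φ y := by
  have : Finite t := ht
  exact congrArg Subtype.val <| isPreconnected_iff_preconnectedSpace.1 hs |>.constant
    (f := fun z : s => (⟨φ z, h z.2⟩ : t)) (by fun_prop) (x := ⟨x, hx⟩) (y := ⟨y, hy⟩)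

variable {Γ : Type*} [Group Γ] [TopologicalSpace Γ] [IsTopologicalGroup Γ]
  {V : Type*} [AddCommGroup V] [Module ℂ V] [FiniteDimensional ℂ V]

/-- The inductive step of Lie–Kolchin. The weight `χ` of `⁅H, H⁆` on `v` is invariant under
conjugation by the connected group `H`, so its weight space `W` is `H`-stable. On `W` each
commutator of elements of `H` is a scalar of determinant 1, hence a root of unity, hence 1 by
connectedness. Thus `H` acts on `W` by commuting operators. -/
theorem exists_eigenvector_of_commutator (ρ : Γ →* End ℂ V)
    (hρ : ∀ v (f : Dual ℂ V), Continuous fun g => f (ρ g v)) (H : Subgroup Γ)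
    (hH : IsPreconnected (H : Set Γ)) {v : V} (hv : v ≠ 0)
    (hK : ∀ k ∈ ⁅H, H⁆, ∃ c : ℂ, ρ k v = c • v) :
    ∃ v : V, v ≠ 0 ∧ ∀ h ∈ H, ∃ c : ℂ, ρ h v = c • v := by
  obtain ⟨f, hf⟩ : ∃ f : Dual ℂ V, f v = 1 := by
    exact Module.Projective.exists_dual_eq_one ℂ hv
  set χ : Γ → ℂ := fun k => f (ρ k v) with hχ
  have hχv : ∀ k ∈ ⁅H, H⁆, ρ k v = χ k • v := by
    intro k hk
    obtain ⟨c, hc⟩ := hK k hk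
    simp [hχ, hc, hf]
  have hinv : ∀ (g : Γ) (w : V), ρ g⁻¹ (ρ g w) = w := fun g w => by
    rw [← Module.End.mul_apply, ← map_mul]; simp
  have hconj_mem : ∀ h ∈ H, ∀ k ∈ ⁅H, H⁆, h⁻¹ * k * h ∈ ⁅H, H⁆ := by
    intro h hh k hk
    have hkH : k ∈ H := Subgroup.commutator_le_self H hk
    have h1 : k * ⁅k⁻¹, h⁻¹⁆ ∈ ⁅H, H⁆ :=
      mul_mem hk (Subgroup.commutator_mem_commutator (inv_mem hkH) (inv_mem hh))
    convert h1 using 1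
    rw [commutatorElement_def]
    group
  have hconj : ∀ h ∈ H, ∀ k ∈ ⁅H, H⁆, χ (h⁻¹ * k * h) = χ k := by
    intro h hh k hk
    -- For `g` in `H`, the vector `ρ g v` is an eigenvector of `ρ k` with eigenvalue `χ (g⁻¹ * k *
    -- g)`, so only finitely many values can occur.
    have := hH.eq_of_mapsTo_finite (φ := fun h => χ (h⁻¹ * k * h))
      ((hρ v f).comp (by fun_prop)) (Module.End.finite_hasEigenvalue (ρ k))
      (fun g hg => by
        refine End.hasEigenvalue_of_hasEigenvector (x := ρ g v) ⟨?_, ?_⟩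
        · rw [End.mem_eigenspace_iff, ← map_smul, ← hχv _ (hconj_mem g hg k hk),
            ← Module.End.mul_apply, ← Module.End.mul_apply, ← map_mul, ← map_mul]
          congr 2; group
        · intro h0
          exact hv (by rw [← hinv g v, h0, map_zero])) hh (one_mem H)
    simpa using this
  let W : Submodule ℂ V := ⨅ k ∈ ⁅H, H⁆, End.eigenspace (ρ k) (χ k)
  have hW : ∀ w, w ∈ W ↔ ∀ k ∈ ⁅H, H⁆, ρ k w = χ k • w := fun w => by
    simp [W, Submodule.mem_iInf]
  have hWmap : ∀ h : H, ∀ w ∈ W, ρ h w ∈ W := by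
    intro h w hw
    rw [hW] at hw ⊢
    intro k hk
    rw [← hconj h h.2 k hk, ← map_smul, ← hw _ (hconj_mem h h.2 k hk),
      ← Module.End.mul_apply, ← Module.End.mul_apply, ← map_mul, ← map_mul]
    congr 2; group
  have : Nontrivial W := ⟨⟨v, (hW v).2 hχv⟩, 0, by simpa using hv⟩
  let r : H → End ℂ W := fun h => (ρ h).restrict (hWmap h)
  have hr : ∀ a b : H, r a * r b = χ ⁅(a : Γ), b⁆ • (r b * r a) := by
    intro a b
    ext w
    have h1 := (hW _).1 (hWmap b _ (hWmap a w w.2)) ⁅(a : Γ), b⁆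
      (Subgroup.commutator_mem_commutator a.2 b.2)
    refine Eq.trans ?_ h1
    change ρ a (ρ b w) = _
    rw [← Module.End.mul_apply, ← Module.End.mul_apply, ← Module.End.mul_apply, ← map_mul,
      ← map_mul, ← map_mul, commutatorElement_def]
    congr 2; group
  have hdet : ∀ a : H, LinearMap.det (r a) ≠ 0 := by
    intro a h0
    have : r a⁻¹ * r a = 1 := by
      ext w; exact hinv a w
    simpa [h0] using congrArg LinearMap.det this
  have hroot : ∀ a b : H, χ ⁅(a : Γ), b⁆ ^ finrank ℂ W = 1 := by
    intro a b
    have h1 := congrArg LinearMap.det (hr a b)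
    rw [LinearMap.det_smul, map_mul, map_mul, mul_comm (LinearMap.det (r b))] at h1
    exact (mul_eq_right₀ (mul_ne_zero (hdet a) (hdet b))).1 h1.symm
  have hone : ∀ a b : H, χ ⁅(a : Γ), b⁆ = 1 := by
    intro a b
    have hfin : {z : ℂ | z ^ finrank ℂ W = 1}.Finite := by
      refine (Polynomial.nthRootsFinset (finrank ℂ W) (1 : ℂ)).finite_toSet.subset fun z hz => ?_
      exact (Polynomial.mem_nthRootsFinset finrank_pos 1).2 hz
    have := (hH.prod hH).eq_of_mapsTo_finite (φ := fun p : Γ × Γ => χ ⁅p.1, p.2⁆)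
      ((hρ v f).comp (by simp only [commutatorElement_def]; fun_prop)) hfin
      (fun p hp => hroot ⟨p.1, hp.1⟩ ⟨p.2, hp.2⟩) (x := (↑a, ↑b)) ⟨a.2, b.2⟩ (y := (1, 1))
      ⟨one_mem H, one_mem H⟩
    simpa [hχ, hf] using this
  obtain ⟨w, hw0, hw⟩ := exists_common_eigenvector_of_commute r fun a b => by
    rw [commute_iff_eq, hr, hone, one_smul]
  refine ⟨w, by simpa using hw0, fun h hh => ?_⟩
  obtain ⟨c, hc⟩ := hw ⟨h, hh⟩
  exact ⟨c, congrArg Subtype.val hc⟩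

/-- **Lie–Kolchin**: a representation of a connected solvable group has a common eigenvector. -/
theorem exists_common_eigenvector [Nontrivial V] [PreconnectedSpace Γ] [Group.IsSolvable Γ]
    (ρ : Γ →* End ℂ V) (hρ : ∀ v (f : Dual ℂ V), Continuous fun g => f (ρ g v)) :
    ∃ v : V, v ≠ 0 ∧ ∀ g, ∃ c : ℂ, ρ g v = c • v := by
  obtain ⟨N, hN⟩ := Group.IsSolvable.solvable (G := Γ)
  -- Climbs the derived series from its trivial term `N` to the whole group.
  have key : ∀ j ≤ N, ∃ v : V, v ≠ 0 ∧ ∀ h ∈ derivedSeries Γ (N - j), ∃ c : ℂ, ρ h v = c • v := by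
    intro j
    induction j with
    | zero =>
      obtain ⟨v, hv⟩ := exists_ne (0 : V)
      refine fun _ => ⟨v, hv, fun h hh => ⟨1, ?_⟩⟩
      rw [Nat.sub_zero, hN, Subgroup.mem_bot] at hh
      simp [hh]
    | succ j ih =>
      intro hj
      obtain ⟨v, hv, h⟩ := ih (by omega)
      rw [show N - j = N - (j + 1) + 1 by omega, derivedSeries_succ] at h
      exact exists_eigenvector_of_commutator ρ hρ _ (isPreconnected_derivedSeries Γ _) hv h
  simpa using key N le_rfl

end LieKolchin

/-! ### Real invariant flags with line and plane steps. -/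

section RealFlag

open Module

variable {Γ : Type*} [Group Γ] [TopologicalSpace Γ] [IsTopologicalGroup Γ] [PreconnectedSpace Γ]

/-- Split a complex common eigenvector as `u + iw`. Comparing real and imaginary parts of the
eigenvalue equation with eigenvalue `x + iy` gives both formulas. If `u` and `w` are dependent, a
nonzero one of them spans an invariant line. -/
theorem exists_real_eigenvector_or_plane [Group.IsSolvable Γ] {V : Type*} [AddCommGroup V]
    [Module ℝ V] [FiniteDimensional ℝ V] [Nontrivial V] (ρ : Γ →* End ℝ V)
    (hρ : ∀ v (f : Dual ℝ V), Continuous fun g => f (ρ g v)) :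
    (∃ u : V, u ≠ 0 ∧ ∀ g, ∃ c : ℝ, ρ g u = c • u) ∨
      ∃ u w : V, LinearIndependent ℝ ![u, w] ∧ ∀ g, ∃ x y : ℝ,
        ρ g u = x • u - y • w ∧ ρ g w = y • u + x • w := by
  let b := finBasis ℝ V
  have : Nonempty (Fin (finrank ℝ V)) := ⟨⟨0, finrank_pos⟩⟩
  let M : Γ → Matrix (Fin (finrank ℝ V)) (Fin (finrank ℝ V)) ℝ := fun g =>
    LinearMap.toMatrixAlgEquiv b (ρ g)
  let ρC : Γ →* End ℂ (Fin (finrank ℝ V) → ℂ) :=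
    { toFun := fun g => Matrix.toLinAlgEquiv' ((M g).map (algebraMap ℝ ℂ))
      map_one' := by simp [M]
      map_mul' := fun g h => by simp only [M, map_mul, Matrix.map_mul] }
  have hρC : ∀ g v i, ρC g v i = ∑ j, (M g i j : ℂ) * v j := fun g v i => by
    change Matrix.toLinAlgEquiv' ((M g).map (algebraMap ℝ ℂ)) v i = _
    rw [Matrix.toLinAlgEquiv'_apply]
    rfl
  have hcont : ∀ v (f : Dual ℂ (Fin (finrank ℝ V) → ℂ)), Continuous fun g => f (ρC g v) := by
    intro v f
    have hf : (fun g => f (ρC g v)) = fun g =>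
        ∑ i, (∑ j, (M g i j : ℂ) * v j) • f (fun j => if i = j then 1 else 0) := by
      funext g
      rw [LinearMap.pi_apply_eq_sum_univ f]
      simp only [hρC]
    rw [hf]
    have : ∀ i j, Continuous fun g => M g i j := fun i j => by
      simpa [M, LinearMap.toMatrixAlgEquiv_apply] using hρ (b j) (b.coord i)
    fun_prop
  obtain ⟨v, hv, hc⟩ := exists_common_eigenvector ρC hcont
  let u : V := b.equivFun.symm fun i => (v i).re
  let w : V := b.equivFun.symm fun i => (v i).im
  have hM : ∀ g (x : Fin (finrank ℝ V) → ℝ),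
      b.equivFun (ρ g (b.equivFun.symm x)) = fun i => ∑ j, M g i j * x j := by
    intro g x
    ext i
    simp [M, LinearMap.toMatrixAlgEquiv_apply, b.equivFun_symm_apply, mul_comm]
  have huw : ∀ g, ∃ x y : ℝ, ρ g u = x • u - y • w ∧ ρ g w = y • u + x • w := by
    intro g
    obtain ⟨c, hc⟩ := hc g
    have hci : ∀ i, ∑ j, (M g i j : ℂ) * v j = c * v i := fun i => by
      rw [← hρC, hc]; rfl
    refine ⟨c.re, c.im, ?_, ?_⟩ <;> apply b.equivFun.injective <;> rw [hM] <;>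
      simp only [u, w, map_sub, map_add, map_smul, LinearEquiv.apply_symm_apply] <;> ext i
    · simpa using congrArg Complex.re (hci i)
    · simpa [add_comm] using congrArg Complex.im (hci i)
  by_cases hu : u = 0
  · refine Or.inl ⟨w, fun hw => hv ?_, fun g => ?_⟩
    · simp only [u, w, LinearEquiv.map_eq_zero_iff] at hu hw
      ext i
      exact Complex.ext (congrFun hu i) (congrFun hw i)
    · obtain ⟨x, y, -, h⟩ := huw g
      exact ⟨x, by simpa [hu] using h⟩
  · by_cases hli : LinearIndependent ℝ ![u, w]
    · exact Or.inr ⟨u, w, hli, huw⟩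
    · rw [LinearIndependent.pair_iff' hu] at hli
      push Not at hli
      obtain ⟨s, hs⟩ := hli
      refine Or.inl ⟨u, hu, fun g => ?_⟩
      obtain ⟨x, y, h, -⟩ := huw g
      exact ⟨x - y * s, by rw [h, ← hs, sub_smul, mul_smul]⟩

/-- Block upper triangular matrices whose diagonal blocks are positive numbers and `2 × 2`
rotation-scaling matrices; the latter start at the indices in `S`. -/
structure IsRotTriangular {n : ℕ} (S : Set ℕ) (M : Matrix (Fin n) (Fin n) ℝ) : Prop where
  lower : ∀ i j : Fin n, j < i → ¬ ((i : ℕ) = j + 1 ∧ (j : ℕ) ∈ S) → M i j = 0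
  pos : ∀ i : Fin n, (i : ℕ) ∉ S → (∀ k ∈ S, (i : ℕ) ≠ k + 1) → 0 < M i i
  rot : ∀ i j : Fin n, (j : ℕ) = i + 1 → (i : ℕ) ∈ S → M j j = M i i ∧ M j i = - M i j

/-- The bound `k + 1 < d` keeps a `2 × 2` block from straddling the cut at `d`. -/
theorem IsRotTriangular.glue {d m : ℕ} {S T : Set ℕ} (hS : ∀ k ∈ S, k + 1 < d)
    {M : Matrix (Fin (d + m)) (Fin (d + m)) ℝ}
    (h0 : ∀ i j, M (Fin.natAdd d i) (Fin.castAdd m j) = 0)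
    (h1 : IsRotTriangular S (M.submatrix (Fin.castAdd m) (Fin.castAdd m)))
    (h2 : IsRotTriangular T (M.submatrix (Fin.natAdd d) (Fin.natAdd d))) :
    IsRotTriangular (S ∪ (fun k => d + k) '' T) M := by
  have hl : ∀ i : Fin d, (i : ℕ) ∈ S ∪ (fun k => d + k) '' T ↔ (i : ℕ) ∈ S := by
    intro i
    have := i.2
    simp only [Set.mem_union, Set.mem_image, or_iff_left_iff_imp]
    rintro ⟨k, -, hk⟩
    omega
  have hr : ∀ i : ℕ, d + i ∈ S ∪ (fun k => d + k) '' T ↔ i ∈ T := by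
    intro i
    simp only [Set.mem_union, Set.mem_image, Nat.add_left_cancel_iff, exists_eq_right,
      or_iff_right_iff_imp]
    intro h
    have := hS _ h
    omega
  refine ⟨fun i j => ?_, fun i => ?_, fun i j => ?_⟩
  · induction i using Fin.addCases with
    | left i =>
      induction j using Fin.addCases with
      | left j =>
        intro hij hn
        refine h1.lower i j hij ?_
        simpa [hl] using hn
      | right j => intro hij; have := i.2; simp [Fin.lt_def] at hij; omega
    | right i =>
      induction j using Fin.addCases with
      | left j => intro _ _; exact h0 i j
      | right j =>
        intro hij hn
        refine h2.lower i j (by simpa using hij) fun h => hn ?_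
        simp only [Fin.val_natAdd, hr]
        exact ⟨by omega, h.2⟩
  · induction i using Fin.addCases with
    | left i =>
      intro hi hk
      refine h1.pos i (fun h => hi ((hl i).2 h)) fun k hkS => hk k (Or.inl hkS)
    | right i =>
      intro hi hk
      refine h2.pos i (fun h => hi ((hr i).2 h)) fun k hkS h => ?_
      refine hk (d + k) ((hr k).2 hkS) ?_
      simp only [Fin.val_natAdd]; omega
  · induction i using Fin.addCases with
    | left i =>
      intro hj hi
      have hi' := (hl i).1 hi
      have := hS _ hi'
      obtain ⟨j, rfl⟩ : ∃ j' : Fin d, j = Fin.castAdd m j' :=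
        ⟨⟨i + 1, this⟩, Fin.ext (by simpa using hj)⟩
      exact h1.rot i j hj hi'
    | right i =>
      intro hj hi
      have hi' := (hr i).1 hi
      have hjlt := j.2
      simp only [Fin.val_natAdd] at hj
      obtain ⟨j, rfl⟩ : ∃ j' : Fin m, j = Fin.natAdd d j' :=
        ⟨⟨i + 1, by omega⟩, Fin.ext (by simp; omega)⟩
      simp only [Fin.val_natAdd] at hj
      exact h2.rot i j (by omega) hi'

/-- Gluing adapted bases of an invariant subspace and of the quotient by it. -/
theorem exists_basis_isRotTriangular_of_quotient {V : Type*} [AddCommGroup V] [Module ℝ V]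
    {ι : Type*} (f : ι → End ℝ V) (W : Submodule ℝ V) (hW : ∀ g, W ≤ W.comap (f g)) {d m : ℕ}
    (bW : Basis (Fin d) ℝ W) (bQ : Basis (Fin m) ℝ (V ⧸ W)) {S T : Set ℕ}
    (hS : ∀ k ∈ S, k + 1 ∉ S ∧ k + 1 < d) (hT : ∀ k ∈ T, k + 1 ∉ T ∧ k + 1 < m)
    (h1 : ∀ g, IsRotTriangular S (LinearMap.toMatrix bW bW ((f g).restrict (hW g))))
    (h2 : ∀ g, IsRotTriangular T (LinearMap.toMatrix bQ bQ (W.mapQ W (f g) (hW g)))) :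
    ∃ (b : Basis (Fin (d + m)) ℝ V) (S : Set ℕ), (∀ k ∈ S, k + 1 ∉ S ∧ k + 1 < d + m) ∧
      ∀ g, IsRotTriangular S (LinearMap.toMatrix b b (f g)) := by
  have hQ : ∀ v i, (bW.sumQuot bQ).repr v (Sum.inr i) = bQ.repr (W.mkQ v) i := by
    intro v i
    have : (bW.sumQuot bQ).coord (Sum.inr i) = (bQ.coord i).comp W.mkQ := by
      refine (bW.sumQuot bQ).ext ?_
      rintro (j | j)
      · simp [(Submodule.Quotient.mk_eq_zero W).2 (bW j).2]
      · have := Basis.sumQuot_inr bW bQ j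
        simp [this, Finsupp.single_apply]
    exact LinearMap.congr_fun this v
  have hWr : ∀ (w : W) i, (bW.sumQuot bQ).repr w (Sum.inl i) = bW.repr w i := by
    intro w i
    have : ((bW.sumQuot bQ).coord (Sum.inl i)).comp W.subtype = bW.coord i := by
      refine bW.ext fun j => ?_
      simp [Finsupp.single_apply]
    exact LinearMap.congr_fun this w
  refine ⟨(bW.sumQuot bQ).reindex finSumFinEquiv, S ∪ (fun k => d + k) '' T, ?_, fun g => ?_⟩
  · rintro k (hk | ⟨k, hk, rfl⟩)
    · obtain ⟨h, h'⟩ := hS k hk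
      refine ⟨?_, by omega⟩
      rintro (h'' | ⟨l, -, hl⟩)
      · exact h h''
      · simp only at hl
        omega
    · obtain ⟨h, h'⟩ := hT k hk
      refine ⟨?_, by simp only; omega⟩
      rintro (h'' | ⟨l, hl', hl⟩)
      · have := (hS _ h'').2
        simp only at this
        omega
      · obtain rfl : l = k + 1 := by simp only at hl; omega
        exact h hl'
  · refine IsRotTriangular.glue (fun k hk => (hS k hk).2) (fun i j => ?_) ?_ ?_
    · have : (f g (bW j)) ∈ W := hW g (bW j).2
      simp [LinearMap.toMatrix_apply, hQ, (Submodule.Quotient.mk_eq_zero W).2 this]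
    · convert h1 g using 1
      ext i j
      simp only [Matrix.submatrix_apply, LinearMap.toMatrix_apply, Basis.reindex_apply,
        Basis.repr_reindex_apply, finSumFinEquiv_symm_apply_castAdd, Basis.sumQuot_inl]
      exact hWr ((f g).restrict (hW g) (bW j)) i
    · convert h2 g using 1
      ext i j
      simp only [Matrix.submatrix_apply, LinearMap.toMatrix_apply, Basis.reindex_apply,
        Basis.repr_reindex_apply, finSumFinEquiv_symm_apply_natAdd, hQ]
      rw [← Basis.sumQuot_inr bW bQ j]
      rfl

/-- Continuity is required only of the coefficients `f (ρ g v)`: in this form it passes to a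
quotient by pulling functionals back, with no topology on `V`. -/
theorem exists_basis_isRotTriangular [Group.IsSolvable Γ] {V : Type*} [AddCommGroup V]
    [Module ℝ V] [FiniteDimensional ℝ V] (ρ : Γ →* End ℝ V)
    (hρ : ∀ v (f : Dual ℝ V), Continuous fun g => f (ρ g v)) {n : ℕ} (hn : finrank ℝ V = n) :
    ∃ (b : Basis (Fin n) ℝ V) (S : Set ℕ), (∀ k ∈ S, k + 1 ∉ S ∧ k + 1 < n) ∧
      ∀ g, IsRotTriangular S (LinearMap.toMatrix b b (ρ g)) := by
  induction n using Nat.strong_induction_on generalizing V with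
  | _ n ih =>
  rcases Nat.eq_zero_or_pos n with rfl | hpos
  · exact ⟨finBasisOfFinrankEq ℝ V hn, ∅, by simp, fun g =>
      ⟨fun i => i.elim0, fun i => i.elim0, fun i => i.elim0⟩⟩
  have : Nontrivial V := finrank_pos_iff.1 (hn ▸ hpos)
  -- Treats the invariant line (`d = 1`) and the invariant plane (`d = 2`) uniformly.
  suffices h : ∃ (d : ℕ) (v : Fin d → V) (S : Set ℕ), 0 < d ∧ LinearIndependent ℝ v ∧
      (∀ k ∈ S, k + 1 ∉ S ∧ k + 1 < d) ∧ ∀ g, ∃ A : Matrix (Fin d) (Fin d) ℝ,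
        IsRotTriangular S A ∧ ∀ j, ρ g (v j) = ∑ i, A i j • v i by
    obtain ⟨d, v, S, hd, hv, hS, hA⟩ := h
    let W := Submodule.span ℝ (Set.range v)
    let bW : Basis (Fin d) ℝ W := Basis.span hv
    have hbW : ∀ i, (bW i : V) = v i := fun i =>
      congrArg Subtype.val (Basis.span_apply hv i)
    have hW : ∀ g, W ≤ W.comap (ρ g) := by
      intro g
      rw [Submodule.span_le]
      rintro _ ⟨j, rfl⟩
      obtain ⟨A, -, h⟩ := hA g
      change ρ g (v j) ∈ W
      rw [h]
      exact Submodule.sum_mem _ fun i _ => W.smul_mem _ (Submodule.subset_span ⟨i, rfl⟩)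
    have hdW : finrank ℝ W = d := by simp [finrank_eq_card_basis bW]
    have hsum := W.finrank_quotient_add_finrank
    let ρQ : Γ →* End ℝ (V ⧸ W) :=
      { toFun := fun g => W.mapQ W (ρ g) (hW g)
        map_one' := by ext; simp
        map_mul' := fun g h => by ext; simp }
    obtain ⟨m, rfl⟩ : ∃ m, n = d + m := ⟨n - d, by omega⟩
    obtain ⟨bQ, T, hT, hQ⟩ := ih m (by omega) ρQ (fun x f => by
      obtain ⟨x, rfl⟩ := W.mkQ_surjective x
      exact hρ x (f.comp W.mkQ)) (by omega)
    refine exists_basis_isRotTriangular_of_quotient ρ W hW bW bQ hS hT (fun g => ?_) hQ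
    obtain ⟨A, hA, h⟩ := hA g
    convert hA
    rw [← LinearEquiv.eq_symm_apply]
    refine bW.ext fun j => Subtype.ext ?_
    simp [LinearMap.toMatrix_symm, Matrix.toLin_self, hbW, h]
  rcases exists_real_eigenvector_or_plane ρ hρ with ⟨u, hu, h⟩ | ⟨u, w, huw, h⟩
  · refine ⟨1, ![u], ∅, one_pos, by simpa using hu, by simp, fun g => ?_⟩
    obtain ⟨f, hf⟩ := Module.Projective.exists_dual_eq_one ℝ hu
    have hχ : ∀ g, ρ g u = f (ρ g u) • u := fun g => by
      obtain ⟨c, hc⟩ := h g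
      simp [hc, hf]
    have hne : ∀ g, f (ρ g u) ≠ 0 := fun g h0 => by
      have h1 : ρ g⁻¹ (ρ g u) = u := by rw [← Module.End.mul_apply, ← map_mul]; simp
      rw [hχ g, h0, zero_smul, map_zero] at h1
      exact hu h1.symm
    -- The character takes the value 1 at the identity and never vanishes, so the intermediate value
    -- theorem excludes nonpositive values.
    have hpos : 0 < f (ρ g u) := by
      by_contra hle
      push Not at hle
      obtain ⟨g', hg'⟩ := mem_range_of_exists_le_of_exists_ge (hρ u f) ⟨g, hle⟩
        ⟨1, by simp [hf]⟩
      exact hne g' hg'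
    refine ⟨!![f (ρ g u)], ⟨fun i j hij => by omega, fun i _ _ => ?_, by simp⟩, fun j => ?_⟩
    · fin_cases i; simpa using hpos
    · fin_cases j; simpa using hχ g
  · refine ⟨2, ![u, w], {0}, two_pos, huw, by simp, fun g => ?_⟩
    obtain ⟨x, y, h1, h2⟩ := h g
    refine ⟨!![x, y; -y, x], ⟨?_, ?_, ?_⟩, ?_⟩
    · simp [Fin.forall_fin_two]
    · simp [Fin.forall_fin_two]
    · simp [Fin.forall_fin_two]
    · simp [Fin.forall_fin_two, h1, h2, Fin.sum_univ_two, sub_eq_add_neg]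

end RealFlag

/-! ### Simultaneous diagonalization of rotation-scaling matrices. -/

noncomputable section

namespace RealAlg

variable {n : ℕ}

/-- `σ` exchanges the two members of each two-element fibre of `β` and fixes the other indices. -/
structure IsPairing (β : Fin n → ℕ) (σ : Fin n → Fin n) : Prop where
  invol : ∀ i, σ (σ i) = i
  eq_iff : ∀ i j, β i = β j ↔ j = i ∨ j = σ i

/-- Direct sums of real scalars and of blocks `(x, y; -y, x)`, the blocks being given by `σ`. -/
structure IsRotDiag (σ : Fin n → Fin n) (M : Matrix (Fin n) (Fin n) ℝ) : Prop where
  off : ∀ i j, j ≠ i → j ≠ σ i → M i j = 0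
  diag : ∀ i, M (σ i) (σ i) = M i i
  anti : ∀ i, σ i ≠ i → M (σ i) i = - M i (σ i)

/-- The matrix whose columns are the joint eigenvectors of the matrices satisfying `IsRotDiag`. -/
def eigenbasis (σ : Fin n → Fin n) : Matrix (Fin n) (Fin n) ℂ :=
  of fun i j => if j = i then 1 else if j = σ i then Complex.I else 0

def eigenbasisInv (σ : Fin n → Fin n) : Matrix (Fin n) (Fin n) ℂ :=
  of fun i j => if j = i then (if σ i = i then 1 else 1 / 2) else
    if j = σ i then -Complex.I / 2 else 0

theorem sum_eq_of_forall_eq_zero {σ : Fin n → Fin n} {R : Type*} [AddCommMonoid R] {i : Fin n}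
    {f : Fin n → R} (hf : ∀ j, j ≠ i → j ≠ σ i → f j = 0) :
    ∑ j, f j = f i + if σ i = i then 0 else f (σ i) := by
  split_ifs with h
  · rw [add_zero]
    exact Finset.sum_eq_single i (fun j _ hj => hf j hj (by rwa [h])) (by simp)
  · rw [← Finset.sum_pair (Ne.symm h)]
    refine (Finset.sum_subset (Finset.subset_univ _) fun j _ hj => ?_).symm
    simp only [Finset.mem_insert, Finset.mem_singleton, not_or] at hj
    exact hf j hj.1 hj.2

theorem eigenbasis_mul_apply (σ : Fin n → Fin n) (A : Matrix (Fin n) (Fin n) ℂ) (i k : Fin n) :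
    (eigenbasis σ * A) i k = A i k + if σ i = i then 0 else Complex.I * A (σ i) k := by
  rw [mul_apply, sum_eq_of_forall_eq_zero (σ := σ) (i := i)]
  · by_cases h : σ i = i <;> simp [eigenbasis, h]
  · intro j h1 h2
    simp [eigenbasis, h1, h2]

theorem eigenbasis_mul_inv {σ : Fin n → Fin n} (hσ : ∀ i, σ (σ i) = i) :
    eigenbasis σ * eigenbasisInv σ = 1 := by
  ext i k
  rw [eigenbasis_mul_apply]
  have hI : Complex.I * (-Complex.I / 2) = 1 / 2 := by
    rw [mul_div_assoc', mul_neg, Complex.I_mul_I, neg_neg]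
  by_cases h : σ i = i
  · by_cases hk : k = i
    · subst hk; simp [eigenbasisInv, h]
    · simp [eigenbasisInv, h, hk, one_apply, Ne.symm hk]
  · have h' : i ≠ σ i := Ne.symm h
    by_cases hk : k = i
    · subst hk
      simp only [eigenbasisInv, of_apply, hσ, h, h', if_true, if_false, hI, one_apply_eq]
      norm_num
    · by_cases hk' : k = σ i
      · subst hk'
        simp only [eigenbasisInv, of_apply, hσ, h, h', if_true, if_false, one_apply_ne h']
        ring
      · simp [eigenbasisInv, hσ, h, hk, hk', one_apply, Ne.symm hk]

theorem eigenbasis_inv_mul {σ : Fin n → Fin n} (hσ : ∀ i, σ (σ i) = i) :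
    eigenbasisInv σ * eigenbasis σ = 1 :=
  mul_eq_one_comm.1 (eigenbasis_mul_inv hσ)

/-- `M` has the columns of `eigenbasis σ` as eigenvectors, with eigenvalues `z`. -/
def HasEigenvalues (σ : Fin n → Fin n) (M : Matrix (Fin n) (Fin n) ℂ) (z : Fin n → ℂ) : Prop :=
  M * eigenbasis σ = eigenbasis σ * diagonal z

namespace HasEigenvalues

variable {σ : Fin n → Fin n} {M N : Matrix (Fin n) (Fin n) ℂ} {z w : Fin n → ℂ}

theorem one : HasEigenvalues σ 1 1 := by simp [HasEigenvalues]

theorem mul (h : HasEigenvalues σ M z) (h' : HasEigenvalues σ N w) :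
    HasEigenvalues σ (M * N) (z * w) := by
  unfold HasEigenvalues at *
  rw [Matrix.mul_assoc, h', ← Matrix.mul_assoc, h, Matrix.mul_assoc, diagonal_mul_diagonal]
  rfl

theorem add (h : HasEigenvalues σ M z) (h' : HasEigenvalues σ N w) :
    HasEigenvalues σ (M + N) (z + w) := by
  unfold HasEigenvalues at *
  rw [Matrix.add_mul, h, h', ← Matrix.mul_add, diagonal_add]
  rfl

theorem smul (h : HasEigenvalues σ M z) (c : ℂ) : HasEigenvalues σ (c • M) (c • z) := by
  unfold HasEigenvalues at *
  rw [Matrix.smul_mul, h, diagonal_smul, Matrix.mul_smul]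

theorem pow (h : HasEigenvalues σ M z) (k : ℕ) : HasEigenvalues σ (M ^ k) (z ^ k) := by
  induction k with
  | zero => simpa using one
  | succ k ih => simpa [pow_succ] using ih.mul h

theorem eq (hσ : ∀ i, σ (σ i) = i) (h : HasEigenvalues σ M z) :
    M = eigenbasis σ * diagonal z * eigenbasisInv σ := by
  rw [← show M * eigenbasis σ = _ from h, Matrix.mul_assoc, eigenbasis_mul_inv hσ, Matrix.mul_one]

theorem conj (hσ : ∀ i, σ (σ i) = i) (z : Fin n → ℂ) :
    HasEigenvalues σ (eigenbasis σ * diagonal z * eigenbasisInv σ) z := by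
  rw [HasEigenvalues, Matrix.mul_assoc, eigenbasis_inv_mul hσ, Matrix.mul_one]

theorem unique (hσ : ∀ i, σ (σ i) = i) (h : HasEigenvalues σ M z) (h' : HasEigenvalues σ M w) :
    z = w := by
  have := congrArg (eigenbasisInv σ * ·) (h.symm.trans h')
  simp only [← Matrix.mul_assoc, eigenbasis_inv_mul hσ, Matrix.one_mul] at this
  exact diagonal_injective this

theorem exp (hσ : ∀ i, σ (σ i) = i) (h : HasEigenvalues σ M z) :
    HasEigenvalues σ (NormedSpace.exp M) fun i => Complex.exp (z i) := by
  have hinv : eigenbasisInv σ = (eigenbasis σ)⁻¹ :=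
    (inv_eq_right_inv (eigenbasis_mul_inv hσ)).symm
  rw [h.eq hσ, hinv, exp_conj _ _ (IsUnit.of_mul_eq_one _ (eigenbasis_mul_inv hσ)), exp_diagonal,
    ← hinv]
  have : NormedSpace.exp z = fun i => Complex.exp (z i) := by
    ext i
    rw [Pi.coe_exp, Complex.exp_eq_exp_ℂ]
  rw [this]
  exact conj hσ _

theorem ne_zero (hσ : ∀ i, σ (σ i) = i) {g : GL (Fin n) ℂ}
    (h : HasEigenvalues σ (g : Matrix (Fin n) (Fin n) ℂ) z) (i : Fin n) : z i ≠ 0 := by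
  have h1 := congrArg det h
  rw [det_mul, det_mul, mul_comm, det_diagonal] at h1
  have hq : (eigenbasis σ).det ≠ 0 := fun h0 => by
    simpa [h0] using congrArg det (eigenbasis_mul_inv hσ)
  have hz : ∏ i, z i ≠ 0 := by
    rw [← mul_left_cancel₀ hq h1]
    exact g.det_ne_zero
  exact Finset.prod_ne_zero_iff.1 hz i (Finset.mem_univ i)

theorem inv (hσ : ∀ i, σ (σ i) = i) {g : GL (Fin n) ℂ}
    (h : HasEigenvalues σ (g : Matrix (Fin n) (Fin n) ℂ) z) :
    HasEigenvalues σ ((g⁻¹ : GL (Fin n) ℂ) : Matrix (Fin n) (Fin n) ℂ) z⁻¹ := by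
  have h0 := h.ne_zero hσ
  have h1 : (g : Matrix (Fin n) (Fin n) ℂ) * (eigenbasis σ * diagonal z⁻¹) = eigenbasis σ := by
    rw [← Matrix.mul_assoc, h, Matrix.mul_assoc, diagonal_mul_diagonal]
    convert Matrix.mul_one _
    rw [← diagonal_one]
    congr 1
    ext i
    simp [h0 i]
  rw [HasEigenvalues]
  nth_rw 1 [← h1]
  rw [← Matrix.mul_assoc, ← Units.val_mul]
  simp

end HasEigenvalues

/-- The eigenvalues of a matrix satisfying `IsRotDiag`. -/
def rotEigenvalues (σ : Fin n → Fin n) (M : Matrix (Fin n) (Fin n) ℝ) (i : Fin n) : ℂ :=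
  M i i + if σ i = i then 0 else M i (σ i) * Complex.I

/-- The real matrix with eigenvalues `z`, provided that `z (σ i)` is conjugate to `z i`. -/
def rotMatrix (σ : Fin n → Fin n) (z : Fin n → ℂ) : Matrix (Fin n) (Fin n) ℝ :=
  of fun i j => if j = i then (z i).re else if j = σ i then (z i).im else 0

theorem IsRotDiag.hasEigenvalues {σ : Fin n → Fin n} (hσ : ∀ i, σ (σ i) = i)
    {M : Matrix (Fin n) (Fin n) ℝ} (hM : IsRotDiag σ M) :
    HasEigenvalues σ (M.map Complex.ofReal) (rotEigenvalues σ M) := by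
  unfold HasEigenvalues
  ext i k
  rw [eigenbasis_mul_apply, mul_apply, sum_eq_of_forall_eq_zero (σ := σ) (i := i)]
  swap
  · intro j h1 h2
    simp [hM.off i j h1 h2]
  by_cases h : σ i = i
  · by_cases hk : k = i
    · subst hk; simp [h, eigenbasis, rotEigenvalues]
    · simp [h, eigenbasis, hk, Ne.symm hk]
  · have h' : i ≠ σ i := Ne.symm h
    have hd : (M (σ i) (σ i) : ℂ) = M i i := congrArg _ (hM.diag i)
    have ha : (M (σ i) i : ℂ) = -M i (σ i) := by rw [hM.anti i h]; simp
    by_cases hk : k = i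
    · subst hk
      simp [eigenbasis, rotEigenvalues, hσ, h, h']
    · by_cases hk' : k = σ i
      · subst hk'
        simp only [h, map_apply, eigenbasis, of_apply, if_true, if_false, hσ, rotEigenvalues, hd,
          ha, diagonal_apply, h', mul_one, zero_add]
        linear_combination (M i (σ i) : ℂ) * Complex.I_mul_I
      · simp [h, eigenbasis, hσ, hk, hk', Ne.symm hk, Ne.symm hk']

theorem isRotDiag_rotMatrix {σ : Fin n → Fin n} (hσ : ∀ i, σ (σ i) = i) {z : Fin n → ℂ}
    (hz : ∀ i, z (σ i) = starRingEnd ℂ (z i)) : IsRotDiag σ (rotMatrix σ z) := by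
  refine ⟨fun i j h1 h2 => by simp [rotMatrix, h1, h2], fun i => by simp [rotMatrix, hz],
    fun i h => ?_⟩
  simp [rotMatrix, hσ, hz, h, Ne.symm h]

theorem rotEigenvalues_rotMatrix {σ : Fin n → Fin n} {z : Fin n → ℂ}
    (hz : ∀ i, z (σ i) = starRingEnd ℂ (z i)) : rotEigenvalues σ (rotMatrix σ z) = z := by
  ext i
  by_cases h : σ i = i
  · have h1 := hz i
    rw [h] at h1
    simp [rotEigenvalues, rotMatrix, h, Complex.conj_eq_iff_re.1 h1.symm]
  · simp [rotEigenvalues, rotMatrix, h, Complex.re_add_im]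

theorem rotMatrix_hasEigenvalues {σ : Fin n → Fin n} (hσ : ∀ i, σ (σ i) = i) {z : Fin n → ℂ}
    (hz : ∀ i, z (σ i) = starRingEnd ℂ (z i)) :
    HasEigenvalues σ ((rotMatrix σ z).map Complex.ofReal) z := by
  simpa only [rotEigenvalues_rotMatrix hz] using
    (isRotDiag_rotMatrix hσ hz).hasEigenvalues hσ

theorem IsRotDiag.rotEigenvalues_conj {σ : Fin n → Fin n} (hσ : ∀ i, σ (σ i) = i)
    {M : Matrix (Fin n) (Fin n) ℝ} (hM : IsRotDiag σ M) (i : Fin n) :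
    rotEigenvalues σ M (σ i) = starRingEnd ℂ (rotEigenvalues σ M i) := by
  by_cases h : σ i = i
  · simp [rotEigenvalues, h]
  · simp [rotEigenvalues, h, hσ, Ne.symm h, hM.diag, hM.anti i h]

theorem map_ofReal_injective :
    Function.Injective fun M : Matrix (Fin n) (Fin n) ℝ => M.map Complex.ofReal :=
  Matrix.map_injective Complex.ofReal_injective

theorem HasEigenvalues.eq_rotMatrix {σ : Fin n → Fin n} (hσ : ∀ i, σ (σ i) = i)
    {M : Matrix (Fin n) (Fin n) ℝ} {z : Fin n → ℂ} (hz : ∀ i, z (σ i) = starRingEnd ℂ (z i))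
    (h : HasEigenvalues σ (M.map Complex.ofReal) z) : M = rotMatrix σ z :=
  map_ofReal_injective ((h.eq hσ).trans ((rotMatrix_hasEigenvalues hσ hz).eq hσ).symm)

theorem map_ofReal_exp (M : Matrix (Fin n) (Fin n) ℝ) :
    (NormedSpace.exp M).map Complex.ofReal = NormedSpace.exp (M.map Complex.ofReal) := by
  open scoped Norms.Operator in
  exact NormedSpace.map_exp (Complex.ofRealHom.mapMatrix : Matrix (Fin n) (Fin n) ℝ →+* _)
    (continuous_id.matrix_map Complex.continuous_ofReal) M

/-- Differentiation at `t = 0`. It carries linear equations from a group to its Lie algebra. -/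
theorem linearMap_eq_zero_of_exp {X : Matrix (Fin n) (Fin n) ℝ}
    (f : Matrix (Fin n) (Fin n) ℝ →ₗ[ℝ] ℝ) (hf : ∀ t : ℝ, f (NormedSpace.exp (t • X)) = 0) :
    f X = 0 := by
  open scoped Norms.Operator in
  have h1 : HasDerivAt (fun t : ℝ => NormedSpace.exp (t • X)) X 0 := by
    exact (hasDerivAt_exp_smul_const X (0 : ℝ)).congr_deriv (by simp)
  have h2 : HasDerivAt (fun t : ℝ => f (NormedSpace.exp (t • X))) (f X) 0 :=
    (LinearMap.toContinuousLinearMap f).hasFDerivAt.comp_hasDerivAt 0 h1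
  simp only [hf] at h2
  exact h2.unique (hasDerivAt_const 0 0)

end RealAlg

end

/-! ### The real torus and its complexification. -/

noncomputable section

namespace RealAlg

variable {n : ℕ}

/-- The eigenvalue vectors of the elements of the real torus attached to `σ`. -/
structure IsAdmissible (σ : Fin n → Fin n) (z : Fin n → ℂ) : Prop where
  conj : ∀ i, z (σ i) = starRingEnd ℂ (z i)
  ne_zero : ∀ i, z i ≠ 0
  pos : ∀ i, σ i = i → 0 < (z i).re

namespace IsAdmissible

variable {σ : Fin n → Fin n} {z w : Fin n → ℂ}

theorem ofReal_re (h : IsAdmissible σ z) {i : Fin n} (hi : σ i = i) : ((z i).re : ℂ) = z i := by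
  have h1 := h.conj i
  rw [hi] at h1
  exact Complex.conj_eq_iff_re.1 h1.symm

theorem one : IsAdmissible σ 1 := ⟨by simp, by simp, by simp⟩

theorem mul (hz : IsAdmissible σ z) (hw : IsAdmissible σ w) : IsAdmissible σ (z * w) := by
  refine ⟨fun i => by simp [hz.conj, hw.conj], fun i => mul_ne_zero (hz.ne_zero i) (hw.ne_zero i),
    fun i hi => ?_⟩
  rw [Pi.mul_apply, ← hz.ofReal_re hi, ← hw.ofReal_re hi, ← Complex.ofReal_mul, Complex.ofReal_re]
  exact mul_pos (hz.pos i hi) (hw.pos i hi)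

theorem inv (hz : IsAdmissible σ z) : IsAdmissible σ z⁻¹ := by
  refine ⟨fun i => by simp [hz.conj], fun i => inv_ne_zero (hz.ne_zero i), fun i hi => ?_⟩
  rw [Pi.inv_apply, ← hz.ofReal_re hi, ← Complex.ofReal_inv, Complex.ofReal_re]
  exact inv_pos.2 (hz.pos i hi)

theorem exp (hz : ∀ i, z (σ i) = starRingEnd ℂ (z i)) :
    IsAdmissible σ fun i => Complex.exp (z i) := by
  refine ⟨fun i => by rw [hz, Complex.exp_conj], fun i => Complex.exp_ne_zero _, fun i hi => ?_⟩
  have h1 := hz i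
  rw [hi] at h1
  rw [← Complex.conj_eq_iff_re.1 h1.symm, ← Complex.ofReal_exp, Complex.ofReal_re]
  exact Real.exp_pos _

theorem exists_log (hσ : ∀ i, σ (σ i) = i) (hz : IsAdmissible σ z) :
    ∃ w : Fin n → ℂ, (∀ i, w (σ i) = starRingEnd ℂ (w i)) ∧ ∀ i, Complex.exp (w i) = z i := by
  -- The principal logarithm does not commute with conjugation on the negative axis, so it is taken
  -- at the smaller index of each pair and conjugated at the other. At fixed indices positivity
  -- makes it real.
  refine ⟨fun i => if i ≤ σ i then Complex.log (z i) else starRingEnd ℂ (Complex.log (z (σ i))),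
    fun i => ?_, fun i => ?_⟩
  · simp only [hσ]
    rcases lt_trichotomy i (σ i) with h | h | h
    · simp [h.le, not_le.2 h]
    · have hi := h.symm
      simp only [hi, le_refl, if_true]
      rw [← hz.ofReal_re hi, ← Complex.ofReal_log (hz.pos i hi).le, Complex.conj_ofReal]
    · simp [h.le, not_le.2 h]
  · simp only
    split_ifs
    · exact Complex.exp_log (hz.ne_zero i)
    · rw [Complex.exp_conj, Complex.exp_log (hz.ne_zero _), ← hz.conj, hσ]

end IsAdmissible

theorem map_ofReal_eq_generalLinearGroup_map (g : GL (Fin n) ℝ) :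
    (g : Matrix (Fin n) (Fin n) ℝ).map Complex.ofReal =
      (GeneralLinearGroup.map Complex.ofRealHom g : GL (Fin n) ℂ) := rfl

/-- The real torus of the matrices satisfying `IsRotDiag` with positive `1 × 1` blocks. -/
def rotTorus (σ : Fin n → Fin n) (hσ : ∀ i, σ (σ i) = i) : Subgroup (GL (Fin n) ℝ) where
  carrier := {c | ∃ z, IsAdmissible σ z ∧
    HasEigenvalues σ ((c : Matrix (Fin n) (Fin n) ℝ).map Complex.ofReal) z}
  one_mem' := ⟨1, IsAdmissible.one, by
    rw [map_ofReal_eq_generalLinearGroup_map, map_one]; exact HasEigenvalues.one⟩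
  mul_mem' := by
    rintro a b ⟨z, hz, ha⟩ ⟨w, hw, hb⟩
    refine ⟨z * w, hz.mul hw, ?_⟩
    rw [map_ofReal_eq_generalLinearGroup_map, map_mul]
    exact ha.mul hb
  inv_mem' := by
    rintro a ⟨z, hz, ha⟩
    refine ⟨z⁻¹, hz.inv, ?_⟩
    rw [map_ofReal_eq_generalLinearGroup_map] at ha ⊢
    rw [map_inv]
    exact ha.inv hσ

variable {σ : Fin n → Fin n} {hσ : ∀ i, σ (σ i) = i}

theorem mem_rotTorus_iff {c : GL (Fin n) ℝ} :
    c ∈ rotTorus σ hσ ↔ IsRotDiag σ (c : Matrix (Fin n) (Fin n) ℝ) ∧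
      ∀ i, σ i = i → 0 < (c : Matrix (Fin n) (Fin n) ℝ) i i := by
  constructor
  · rintro ⟨z, hz, h⟩
    rw [h.eq_rotMatrix hσ hz.conj]
    exact ⟨isRotDiag_rotMatrix hσ hz.conj, fun i hi => by simpa [rotMatrix] using hz.pos i hi⟩
  · rintro ⟨h, hpos⟩
    refine ⟨_, ⟨h.rotEigenvalues_conj hσ, ?_, fun i hi => ?_⟩, h.hasEigenvalues hσ⟩
    · exact HasEigenvalues.ne_zero hσ (g := GeneralLinearGroup.map Complex.ofRealHom c)
        (h.hasEigenvalues hσ)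
    · simpa [rotEigenvalues, hi] using hpos i hi

theorem exists_mem_rotTorus {z : Fin n → ℂ} (hz : IsAdmissible σ z) :
    ∃ c ∈ rotTorus σ hσ, (c : Matrix (Fin n) (Fin n) ℝ) = rotMatrix σ z := by
  have key : ∀ z w : Fin n → ℂ, IsAdmissible σ z → IsAdmissible σ w → z * w = 1 →
      rotMatrix σ z * rotMatrix σ w = 1 := by
    intro z w hz hw h
    apply map_ofReal_injective
    change Complex.ofRealHom.mapMatrix _ = Complex.ofRealHom.mapMatrix _
    rw [map_mul, map_one]
    have h1 := (rotMatrix_hasEigenvalues hσ hz.conj).mul (rotMatrix_hasEigenvalues hσ hw.conj)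
    rw [h] at h1
    exact (h1.eq hσ).trans (HasEigenvalues.one.eq hσ).symm
  refine ⟨⟨rotMatrix σ z, rotMatrix σ z⁻¹, key _ _ hz hz.inv ?_, key _ _ hz.inv hz ?_⟩,
    ⟨z, hz, rotMatrix_hasEigenvalues hσ hz.conj⟩, rfl⟩ <;>
  · ext i
    simp [hz.ne_zero i]

/-- The conditions in `IsRotDiag` are linear, so they descend to the Lie algebra. Positivity leaves
no trace there, because the exponential of a real eigenvalue is positive. -/
theorem mem_lieAlg_rotTorus_iff {X : Matrix (Fin n) (Fin n) ℝ} :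
    X ∈ lieAlg (rotTorus σ hσ) ↔ IsRotDiag σ X := by
  constructor
  · intro hX
    have hrot : ∀ t : ℝ, IsRotDiag σ (NormedSpace.exp (t • X)) := fun t => by
      obtain ⟨h, hh, he⟩ := hX t
      exact he ▸ (mem_rotTorus_iff.1 hh).1
    refine ⟨fun i j h1 h2 => ?_, fun i => ?_, fun i hi => ?_⟩
    · exact linearMap_eq_zero_of_exp (entryLinearMap ℝ ℝ i j) fun t => (hrot t).off i j h1 h2
    · exact sub_eq_zero.1 <| linearMap_eq_zero_of_exp
        (entryLinearMap ℝ ℝ (σ i) (σ i) - entryLinearMap ℝ ℝ i i) fun t =>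
          sub_eq_zero.2 ((hrot t).diag i)
    · exact eq_neg_of_add_eq_zero_left <| linearMap_eq_zero_of_exp
        (entryLinearMap ℝ ℝ (σ i) i + entryLinearMap ℝ ℝ i (σ i)) fun t => by
          simp [(hrot t).anti i hi]
  · intro hX t
    obtain ⟨u, hu⟩ := isUnit_exp (t • X)
    refine ⟨u, ?_, hu⟩
    have h1 := (hX.hasEigenvalues hσ).smul (t : ℂ)
    have h2 : (t : ℂ) • X.map Complex.ofReal = (t • X).map Complex.ofReal := by
      ext i j; simp
    rw [h2] at h1
    refine ⟨_, IsAdmissible.exp (z := (t : ℂ) • rotEigenvalues σ X) fun i => ?_, ?_⟩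
    · simp [hX.rotEigenvalues_conj hσ]
    · rw [hu, map_ofReal_exp]
      exact h1.exp hσ

/-- Each element is a single exponential, by `IsAdmissible.exists_log`. -/
theorem isConnectedLie_rotTorus : IsConnectedLie (rotTorus σ hσ) := by
  refine le_antisymm (fun c hc => ?_) ((Subgroup.closure_le _).2 ?_)
  · obtain ⟨z, hz, h⟩ := hc
    obtain ⟨w, hw, hwz⟩ := hz.exists_log hσ
    refine Subgroup.subset_closure ⟨rotMatrix σ w,
      mem_lieAlg_rotTorus_iff.2 (isRotDiag_rotMatrix hσ hw), map_ofReal_injective ?_⟩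
    simp only
    rw [map_ofReal_exp, h.eq hσ, ((rotMatrix_hasEigenvalues hσ hw).exp hσ).eq hσ]
    simp only [hwz]
  · rintro c ⟨X, hX, h⟩
    obtain ⟨d, hd, h'⟩ := hX 1
    rw [one_smul, ← h] at h'
    exact Units.ext h' ▸ hd

theorem mem_complexification_rotTorus_iff {g : GL (Fin n) ℂ} :
    g ∈ complexification (rotTorus σ hσ) ↔
      ∃ z, HasEigenvalues σ (g : Matrix (Fin n) (Fin n) ℂ) z := by
  constructor
  · intro hg
    induction hg using Subgroup.closure_induction with
    | mem g hg =>
      obtain ⟨X, hX, Y, hY, h⟩ := hg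
      rw [mem_lieAlg_rotTorus_iff] at hX hY
      rw [h]
      exact ⟨_, ((hX.hasEigenvalues hσ).add ((hY.hasEigenvalues hσ).smul Complex.I)).exp hσ⟩
    | one => exact ⟨1, HasEigenvalues.one⟩
    | mul a b _ _ ha hb =>
      obtain ⟨z, hz⟩ := ha
      obtain ⟨w, hw⟩ := hb
      exact ⟨z * w, hz.mul hw⟩
    | inv a _ ha =>
      obtain ⟨z, hz⟩ := ha
      exact ⟨z⁻¹, hz.inv hσ⟩
  · rintro ⟨z, hz⟩
    let w : Fin n → ℂ := fun i => Complex.log (z i)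
    -- The real and imaginary parts of `w` for the conjugation that sends `w` to the conjugate of `w
    -- ∘ σ`.
    let x : Fin n → ℂ := fun i => (w i + starRingEnd ℂ (w (σ i))) / 2
    let y : Fin n → ℂ := fun i => (w i - starRingEnd ℂ (w (σ i))) / (2 * Complex.I)
    have hx : ∀ i, x (σ i) = starRingEnd ℂ (x i) := fun i => by
      simp [x, hσ, add_comm, Complex.conj_ofNat]
    have hy : ∀ i, y (σ i) = starRingEnd ℂ (y i) := fun i => by
      simp only [y, hσ, map_div₀, map_sub, map_mul, Complex.conj_conj, Complex.conj_I,
        Complex.conj_ofNat]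
      rw [mul_neg, div_neg, ← neg_div, neg_sub]
    have hxy : ∀ i, x i + Complex.I * y i = w i := fun i => by
      simp only [x, y]
      field_simp [Complex.I_ne_zero]
      ring
    refine Subgroup.subset_closure ⟨rotMatrix σ x,
      mem_lieAlg_rotTorus_iff.2 (isRotDiag_rotMatrix hσ hx), rotMatrix σ y,
      mem_lieAlg_rotTorus_iff.2 (isRotDiag_rotMatrix hσ hy), ?_⟩
    have h := ((rotMatrix_hasEigenvalues hσ hx).add
      ((rotMatrix_hasEigenvalues hσ hy).smul Complex.I)).exp hσ
    rw [hz.eq hσ, h.eq hσ]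
    congr 3
    ext i
    simp [hxy, w, Complex.exp_log (hz.ne_zero hσ i)]

theorem hasEigenvalues_iff_isDiag (hσ : ∀ i, σ (σ i) = i) {M : Matrix (Fin n) (Fin n) ℂ} :
    (∃ z, HasEigenvalues σ M z) ↔ (eigenbasisInv σ * M * eigenbasis σ).IsDiag := by
  constructor
  · rintro ⟨z, hz⟩
    rw [Matrix.mul_assoc, hz, ← Matrix.mul_assoc, eigenbasis_inv_mul hσ, Matrix.one_mul]
    exact isDiag_diagonal z
  · intro h
    refine ⟨_, (?_ : _ = eigenbasis σ * diagonal (diag (eigenbasisInv σ * M * eigenbasis σ)))⟩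
    rw [h.diagonal_diag, ← Matrix.mul_assoc, ← Matrix.mul_assoc, eigenbasis_mul_inv hσ,
      Matrix.one_mul]

theorem isZariskiClosed_complexification_rotTorus :
    IsZariskiClosed (complexification (rotTorus σ hσ)) := by
  refine ⟨{p | ∃ i j, i ≠ j ∧ p = ∑ b, (∑ a, MvPolynomial.C (eigenbasisInv σ i a) *
    MvPolynomial.X (a, b)) * MvPolynomial.C (eigenbasis σ b j)}, fun g => ?_⟩
  rw [mem_complexification_rotTorus_iff, hasEigenvalues_iff_isDiag hσ]
  have : ∀ i j, MvPolynomial.eval (fun ij => (g : Matrix (Fin n) (Fin n) ℂ) ij.1 ij.2)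
      (∑ b, (∑ a, MvPolynomial.C (eigenbasisInv σ i a) * MvPolynomial.X (a, b)) *
        MvPolynomial.C (eigenbasis σ b j)) =
      (eigenbasisInv σ * (g : Matrix (Fin n) (Fin n) ℂ) * eigenbasis σ) i j := fun i j => by
    simp [mul_apply]
  constructor
  · rintro h _ ⟨i, j, hij, rfl⟩
    rw [this]
    exact h hij
  · intro h i j hij
    rw [← this]
    exact h _ ⟨i, j, hij, rfl⟩

/-- It is the image of the space of logarithms under the exponential. -/
theorem isConnected_complexification_rotTorus :
    IsConnected (complexification (rotTorus σ hσ) : Set (GL (Fin n) ℂ)) := by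
  have hone : ∀ w w' : Fin n → ℂ, w + w' = 0 →
      (eigenbasis σ * diagonal (fun i => Complex.exp (w i)) * eigenbasisInv σ) *
        (eigenbasis σ * diagonal (fun i => Complex.exp (w' i)) * eigenbasisInv σ) = 1 := by
    intro w w' h
    have h1 := (HasEigenvalues.conj hσ fun i => Complex.exp (w i)).mul
      (HasEigenvalues.conj hσ fun i => Complex.exp (w' i))
    have h2 : ((fun i => Complex.exp (w i)) * fun i => Complex.exp (w' i)) = 1 := by
      ext i
      rw [Pi.mul_apply, ← Complex.exp_add, ← Pi.add_apply, h]
      simp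
    rw [h2] at h1
    exact (h1.eq hσ).trans (HasEigenvalues.one.eq hσ).symm
  let F : (Fin n → ℂ) → GL (Fin n) ℂ := fun w =>
    ⟨eigenbasis σ * diagonal (fun i => Complex.exp (w i)) * eigenbasisInv σ,
      eigenbasis σ * diagonal (fun i => Complex.exp ((-w) i)) * eigenbasisInv σ,
      hone _ _ (by simp), hone _ _ (by simp)⟩
  have hF : Continuous F := by
    rw [Units.continuous_iff]
    constructor
    · change Continuous fun w : Fin n → ℂ =>
        eigenbasis σ * diagonal (fun i => Complex.exp (w i)) * eigenbasisInv σ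
      fun_prop
    · change Continuous fun w : Fin n → ℂ =>
        eigenbasis σ * diagonal (fun i => Complex.exp ((-w) i)) * eigenbasisInv σ
      fun_prop
  convert isConnected_range hF
  ext g
  rw [SetLike.mem_coe, mem_complexification_rotTorus_iff]
  constructor
  · rintro ⟨z, hz⟩
    refine ⟨fun i => Complex.log (z i), Units.ext ?_⟩
    rw [hz.eq hσ]
    simp [F, Complex.exp_log (hz.ne_zero hσ _)]
  · rintro ⟨w, rfl⟩
    exact ⟨_, HasEigenvalues.conj hσ _⟩

/-- The eigenvector matrix as an element of the general linear group. -/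
def eigenbasisUnit (σ : Fin n → Fin n) (hσ : ∀ i, σ (σ i) = i) : GL (Fin n) ℂ :=
  ⟨eigenbasis σ, eigenbasisInv σ, eigenbasis_mul_inv hσ, eigenbasis_inv_mul hσ⟩

theorem isTorus_complexification_rotTorus : IsTorus (complexification (rotTorus σ hσ)) := by
  refine ⟨isZariskiClosed_complexification_rotTorus, isConnected_complexification_rotTorus,
    (eigenbasisUnit σ hσ)⁻¹, fun t ht => ?_⟩
  rw [inv_inv]
  exact (hasEigenvalues_iff_isDiag hσ).1 (mem_complexification_rotTorus_iff.1 ht)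

theorem isSemisimpleElt_of_mem_rotTorus {c : GL (Fin n) ℝ} (hc : c ∈ rotTorus σ hσ) :
    IsSemisimpleElt c := by
  obtain ⟨z, -, h⟩ := hc
  refine ⟨(eigenbasisUnit σ hσ)⁻¹, ?_⟩
  rw [inv_inv]
  exact (hasEigenvalues_iff_isDiag hσ).1 ⟨z, h⟩

theorem IsTorus.mul_comm {T : Subgroup (GL (Fin n) ℂ)} (hT : IsTorus T) {s t : GL (Fin n) ℂ}
    (hs : s ∈ T) (ht : t ∈ T) : s * t = t * s := by
  obtain ⟨-, -, p, hp⟩ := hT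
  have hd : (p * s * p⁻¹) * (p * t * p⁻¹) = (p * t * p⁻¹) * (p * s * p⁻¹) := by
    have key : ∀ A B : Matrix (Fin n) (Fin n) ℂ, A.IsDiag → B.IsDiag → A * B = B * A := by
      intro A B hA hB
      rw [← hA.diagonal_diag, ← hB.diagonal_diag, diagonal_mul_diagonal, diagonal_mul_diagonal]
      simp [_root_.mul_comm]
    exact Units.ext (key _ _ (hp s hs) (hp t ht))
  have h2 : p * (s * t) * p⁻¹ = p * (t * s) * p⁻¹ := by
    simpa [mul_assoc] using hd
  exact mul_left_cancel (mul_right_cancel h2)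

/-- A torus is commutative, and the smaller torus already contains an element with distinct
eigenvalues, which only matrices diagonal in the same eigenbasis commute with. -/
theorem le_complexification_rotTorus_of_isTorus {T : Subgroup (GL (Fin n) ℂ)} (hT : IsTorus T)
    (h : complexification (rotTorus σ hσ) ≤ T) : T ≤ complexification (rotTorus σ hσ) := by
  intro t ht
  -- Distinct eigenvalues; the shift by 1 makes them nonzero.
  let z : Fin n → ℂ := fun i => ((i : ℕ) : ℂ) + 1
  have hz0 : ∀ i, z i ≠ 0 := fun i => Nat.cast_add_one_ne_zero _
  have hinj : Function.Injective z := fun i j hij => Fin.ext (by simpa [z] using hij)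
  obtain ⟨s, hs⟩ : ∃ s : GL (Fin n) ℂ,
      HasEigenvalues σ (s : Matrix (Fin n) (Fin n) ℂ) z := by
    let d : GL (Fin n) ℂ := ⟨diagonal z, diagonal z⁻¹, by
      rw [diagonal_mul_diagonal, ← diagonal_one]; simp [hz0], by
      rw [diagonal_mul_diagonal, ← diagonal_one]; simp [hz0]⟩
    exact ⟨eigenbasisUnit σ hσ * d * (eigenbasisUnit σ hσ)⁻¹, HasEigenvalues.conj hσ z⟩
  have hst : (s : Matrix (Fin n) (Fin n) ℂ) * t = t * s :=
    congrArg Units.val (hT.mul_comm (h (mem_complexification_rotTorus_iff.2 ⟨z, hs⟩)) ht)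
  rw [mem_complexification_rotTorus_iff, hasEigenvalues_iff_isDiag hσ]
  set A := eigenbasisInv σ * (t : Matrix (Fin n) (Fin n) ℂ) * eigenbasis σ with hA
  have hcomm : diagonal z * A = A * diagonal z := by
    rw [hs.eq hσ] at hst
    have := congrArg (fun M => eigenbasisInv σ * M * eigenbasis σ) hst
    simp only [← Matrix.mul_assoc, eigenbasis_inv_mul hσ, Matrix.one_mul] at this
    simp only [Matrix.mul_assoc, eigenbasis_inv_mul hσ, Matrix.mul_one] at this
    simpa only [hA, Matrix.mul_assoc] using this
  intro i j hij
  have h1 := congrFun (congrFun hcomm i) j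
  rw [diagonal_mul, mul_diagonal, _root_.mul_comm] at h1
  have h2 : A i j * (z i - z j) = 0 := by rw [mul_sub, h1, sub_self]
  exact (mul_eq_zero.1 h2).resolve_right (sub_ne_zero.2 (hinj.ne hij))

theorem complexification_mono {H K : Subgroup (GL (Fin n) ℝ)} (h : H ≤ K) :
    complexification H ≤ complexification K := by
  have hl : lieAlg H ⊆ lieAlg K := fun X hX t => (hX t).imp fun g hg => ⟨h hg.1, hg.2⟩
  refine Subgroup.closure_mono ?_
  rintro g ⟨X, hX, Y, hY, hg⟩
  exact ⟨X, hl hX, Y, hl hY, hg⟩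

theorem isCartanSubgroup_rotTorus {P : Subgroup (GL (Fin n) ℝ)} (h : rotTorus σ hσ ≤ P) :
    IsCartanSubgroup (rotTorus σ hσ) P :=
  ⟨h, isConnectedLie_rotTorus, ⟨isTorus_complexification_rotTorus, complexification_mono h⟩,
    fun _ hT hle => le_complexification_rotTorus_of_isTorus hT.1 hle⟩

end RealAlg

end

/-! ### Block diagonal parts, the unipotent radical and the semidirect product. -/

noncomputable section

namespace RealAlg

variable {n : ℕ}

/-- The block diagonal part of a matrix. -/
def diagPart (β : Fin n → ℕ) (M : Matrix (Fin n) (Fin n) ℝ) : Matrix (Fin n) (Fin n) ℝ :=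
  of fun i j => if β i = β j then M i j else 0

theorem diagPart_apply_of_eq {β : Fin n → ℕ} {M : Matrix (Fin n) (Fin n) ℝ} {i j : Fin n}
    (h : β i = β j) : diagPart β M i j = M i j := by simp [diagPart, h]

theorem diagPart_one (β : Fin n → ℕ) : diagPart β 1 = 1 := by
  ext i j
  by_cases h : i = j
  · subst h
    simp [diagPart]
  · simp [diagPart, one_apply_ne h]

theorem diagPart_sub (β : Fin n → ℕ) (M N : Matrix (Fin n) (Fin n) ℝ) :
    diagPart β (M - N) = diagPart β M - diagPart β N := by
  ext i j
  by_cases h : β i = β j <;> simp [diagPart, h]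

/-- In an entry with `β i = β k`, the factor `M i j` kills the terms with `β j < β i` and `N j k`
those with `β j > β k`. -/
theorem diagPart_mul {β : Fin n → ℕ} {M N : Matrix (Fin n) (Fin n) ℝ} (hM : BlockTriangular M β)
    (hN : BlockTriangular N β) : diagPart β (M * N) = diagPart β M * diagPart β N := by
  ext i k
  simp only [diagPart, of_apply, mul_apply]
  split_ifs with h
  · refine Finset.sum_congr rfl fun j _ => ?_
    rcases lt_trichotomy (β j) (β i) with hj | hj | hj
    · simp [hM hj, hj.ne']
    · simp [hj, h]
    · simp [hN (h ▸ hj), hj.ne]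
  · refine (Finset.sum_eq_zero fun j _ => ?_).symm
    by_cases hj : β i = β j
    · simp [← hj, h]
    · simp [hj]

theorem diagPart_pow {β : Fin n → ℕ} {M : Matrix (Fin n) (Fin n) ℝ} (hM : BlockTriangular M β)
    (k : ℕ) : BlockTriangular (M ^ k) β ∧ diagPart β (M ^ k) = diagPart β M ^ k := by
  induction k with
  | zero => simpa using ⟨blockTriangular_one, diagPart_one β⟩
  | succ k ih =>
    rw [pow_succ, pow_succ, ← ih.2, ← diagPart_mul ih.1 hM]
    exact ⟨ih.1.mul hM, rfl⟩

theorem isNilpotent_diagPart {β : Fin n → ℕ} {M : Matrix (Fin n) (Fin n) ℝ}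
    (hM : BlockTriangular M β) (h : IsNilpotent M) : IsNilpotent (diagPart β M) := by
  obtain ⟨k, hk⟩ := h
  refine ⟨k, ?_⟩
  rw [← (diagPart_pow hM k).2, hk]
  ext i j
  simp [diagPart]

theorem isNilpotent_of_strictly_blockTriangular {β : Fin n → ℕ} {M : Matrix (Fin n) (Fin n) ℝ}
    (hM : ∀ i j, β j ≤ β i → M i j = 0) : IsNilpotent M := by
  -- Every factor of `M` raises the block index by at least one.
  have key : ∀ k i j, β j < β i + k → (M ^ k) i j = 0 := by
    intro k
    induction k with
    | zero =>
      intro i j h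
      rw [pow_zero, one_apply_ne]
      rintro rfl
      omega
    | succ k ih =>
      intro i j h
      rw [pow_succ, mul_apply]
      refine Finset.sum_eq_zero fun l _ => ?_
      by_cases hl : β l < β i + k
      · rw [ih i l hl, zero_mul]
      · rw [hM l j (by omega), mul_zero]
  refine ⟨∑ i, β i + 1, ?_⟩
  ext i j
  refine key _ i j ?_
  have := Finset.single_le_sum (f := β) (fun _ _ => Nat.zero_le _) (Finset.mem_univ j)
  omega

variable {S : Finset (Fin (n - 1))}

theorem diagPart_mul_of_mem {a b : GL (Fin n) ℝ} (ha : a ∈ stdParabolic S)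
    (hb : b ∈ stdParabolic S) :
    diagPart (blockIdx S) (a * b : GL (Fin n) ℝ) =
      diagPart (blockIdx S) a * diagPart (blockIdx S) b := by
  rw [Units.val_mul]
  exact diagPart_mul ha hb

theorem diagPart_mul_inv_of_mem {a : GL (Fin n) ℝ} (ha : a ∈ stdParabolic S) :
    diagPart (blockIdx S) a * diagPart (blockIdx S) (a⁻¹ : GL (Fin n) ℝ) = 1 := by
  rw [← diagPart_mul_of_mem ha (inv_mem ha), mul_inv_cancel, Units.val_one, diagPart_one]

/-- The group of the block unipotent matrices in the standard parabolic subgroup. -/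
def blockUnipotent (S : Finset (Fin (n - 1))) : Subgroup (GL (Fin n) ℝ) where
  carrier := {g | g ∈ stdParabolic S ∧ diagPart (blockIdx S) (g : Matrix (Fin n) (Fin n) ℝ) = 1}
  one_mem' := ⟨one_mem _, by rw [Units.val_one, diagPart_one]⟩
  mul_mem' := by
    rintro a b ⟨ha, ha'⟩ ⟨hb, hb'⟩
    exact ⟨mul_mem ha hb, by rw [diagPart_mul_of_mem ha hb, ha', hb', one_mul]⟩
  inv_mem' := by
    rintro a ⟨ha, ha'⟩
    exact ⟨inv_mem ha, by simpa [ha'] using diagPart_mul_inv_of_mem ha⟩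

theorem mem_blockUnipotent_iff {g : GL (Fin n) ℝ} :
    g ∈ blockUnipotent S ↔ ∀ i j, blockIdx S j ≤ blockIdx S i →
      (g : Matrix (Fin n) (Fin n) ℝ) i j = (1 : Matrix (Fin n) (Fin n) ℝ) i j := by
  constructor
  · rintro ⟨h, h1⟩ i j hij
    rcases hij.lt_or_eq with hlt | heq
    · rw [h hlt, one_apply_ne]
      rintro rfl
      exact hlt.false
    · rw [← h1, diagPart_apply_of_eq heq.symm]
  · intro h
    refine ⟨fun i j hij => ?_, ?_⟩
    · rw [h i j (le_of_lt hij), one_apply_ne]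
      rintro rfl
      exact lt_irrefl _ hij
    · ext i j
      by_cases hij : blockIdx S i = blockIdx S j
      · rw [diagPart_apply_of_eq hij, h i j hij.ge]
      · rw [one_apply_ne (fun h => hij (congrArg _ h))]
        simp [diagPart, hij]

theorem isUnipotentElt_of_mem_blockUnipotent {g : GL (Fin n) ℝ} (hg : g ∈ blockUnipotent S) :
    IsUnipotentElt g :=
  isNilpotent_of_strictly_blockTriangular (β := blockIdx S) fun i j hij => by
    rw [Matrix.sub_apply, mem_blockUnipotent_iff.1 hg i j hij, sub_self]

theorem conj_mem_blockUnipotent {p g : GL (Fin n) ℝ} (hp : p ∈ stdParabolic S)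
    (hg : g ∈ blockUnipotent S) : p * g * p⁻¹ ∈ blockUnipotent S := by
  refine ⟨mul_mem (mul_mem hp hg.1) (inv_mem hp), ?_⟩
  rw [diagPart_mul_of_mem (mul_mem hp hg.1) (inv_mem hp), diagPart_mul_of_mem hp hg.1, hg.2,
    mul_one, diagPart_mul_inv_of_mem hp]

theorem isZariskiClosed_blockUnipotent : IsZariskiClosed (blockUnipotent S) := by
  refine ⟨{p | ∃ i j, blockIdx S j ≤ blockIdx S i ∧ p = MvPolynomial.X (i, j) -
    MvPolynomial.C ((1 : Matrix (Fin n) (Fin n) ℝ) i j)}, fun g => ?_⟩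
  rw [mem_blockUnipotent_iff]
  constructor
  · rintro h _ ⟨i, j, hij, rfl⟩
    simpa using sub_eq_zero.2 (h i j hij)
  · intro h i j hij
    have := h _ ⟨i, j, hij, rfl⟩
    simpa [sub_eq_zero] using this

/-- The topology on units also involves the inverse; inversion is continuous on the units of a
complete normed ring, so it adds no condition. -/
theorem continuous_generalLinearGroup_iff {X : Type*} [TopologicalSpace X]
    {f : X → GL (Fin n) ℝ} :
    Continuous f ↔ Continuous fun x => (f x : Matrix (Fin n) (Fin n) ℝ) := by
  open scoped Norms.Operator in
  exact (Units.isOpenEmbedding_val (R := Matrix (Fin n) (Fin n) ℝ)).isEmbedding.continuous_iff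

theorem isConnected_blockUnipotent : IsConnected (blockUnipotent S : Set (GL (Fin n) ℝ)) := by
  refine ⟨⟨1, one_mem _⟩, isPreconnected_of_forall 1 fun g hg => ?_⟩
  -- The segment from 1 to `g` consists of unipotent matrices and stays in the group.
  have hunit : ∀ t : ℝ, IsUnit (1 + t • ((g : Matrix (Fin n) (Fin n) ℝ) - 1)) := fun t =>
    ((isUnipotentElt_of_mem_blockUnipotent hg).smul t).isUnit_one_add
  choose f hf using hunit
  have hcont : Continuous f := continuous_generalLinearGroup_iff.2 (by
    simp only [hf]
    fun_prop)
  refine ⟨Set.range f, ?_, ⟨0, ?_⟩, ⟨1, ?_⟩, isPreconnected_range hcont⟩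
  · rintro _ ⟨t, rfl⟩
    refine mem_blockUnipotent_iff.2 fun i j hij => ?_
    rw [hf, Matrix.add_apply, Matrix.smul_apply, Matrix.sub_apply, mem_blockUnipotent_iff.1 hg i j hij]
    simp
  · exact Units.ext (by simp [hf])
  · exact Units.ext (by simp [hf])

variable {σ : Fin n → Fin n}

theorem IsPairing.apply_eq {β : Fin n → ℕ} (h : IsPairing β σ) (i : Fin n) : β i = β (σ i) :=
  (h.eq_iff i (σ i)).2 (Or.inr rfl)

theorem rotTorus_le_stdParabolic (h : IsPairing (blockIdx S) σ) :
    rotTorus σ h.invol ≤ stdParabolic S := by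
  intro c hc i j hij
  refine (mem_rotTorus_iff.1 hc).1.off i j ?_ ?_
  · rintro rfl
    exact lt_irrefl _ hij
  · rintro rfl
    rw [h.apply_eq i] at hij
    exact lt_irrefl _ hij

theorem diagPart_eq_self_of_mem_rotTorus (h : IsPairing (blockIdx S) σ) {c : GL (Fin n) ℝ}
    (hc : c ∈ rotTorus σ h.invol) :
    diagPart (blockIdx S) (c : Matrix (Fin n) (Fin n) ℝ) = c := by
  ext i j
  by_cases hij : blockIdx S i = blockIdx S j
  · exact diagPart_apply_of_eq hij
  · have h1 := mt (h.eq_iff i j).2 hij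
    push Not at h1
    rw [(mem_rotTorus_iff.1 hc).1.off i j h1.1 h1.2]
    simp [diagPart, hij]

/-- The group of the matrices in the standard parabolic subgroup whose block diagonal part lies in
the real torus. -/
def rotBorel (h : IsPairing (blockIdx S) σ) : Subgroup (GL (Fin n) ℝ) where
  carrier := {b | b ∈ stdParabolic S ∧ ∃ c ∈ rotTorus σ h.invol,
    diagPart (blockIdx S) (b : Matrix (Fin n) (Fin n) ℝ) = c}
  one_mem' := ⟨one_mem _, 1, one_mem _, by rw [Units.val_one, diagPart_one]⟩
  mul_mem' := by
    rintro a b ⟨ha, c, hc, hac⟩ ⟨hb, d, hd, hbd⟩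
    exact ⟨mul_mem ha hb, c * d, mul_mem hc hd, by
      rw [diagPart_mul_of_mem ha hb, hac, hbd, Units.val_mul]⟩
  inv_mem' := by
    rintro a ⟨ha, c, hc, hac⟩
    refine ⟨inv_mem ha, c⁻¹, inv_mem hc, ?_⟩
    have h1 := diagPart_mul_inv_of_mem ha
    rw [hac] at h1
    exact (Units.inv_eq_of_mul_eq_one_right h1).symm

theorem mem_rotBorel_iff {h : IsPairing (blockIdx S) σ} {b : GL (Fin n) ℝ} :
    b ∈ rotBorel h ↔ b ∈ stdParabolic S ∧
      IsRotDiag σ (diagPart (blockIdx S) (b : Matrix (Fin n) (Fin n) ℝ)) ∧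
      ∀ i, σ i = i → 0 < (b : Matrix (Fin n) (Fin n) ℝ) i i := by
  refine and_congr_right fun hb => ?_
  constructor
  · rintro ⟨c, hc, hbc⟩
    rw [mem_rotTorus_iff, ← hbc] at hc
    exact ⟨hc.1, fun i hi => by simpa [diagPart] using hc.2 i hi⟩
  · rintro ⟨h1, h2⟩
    refine ⟨⟨diagPart (blockIdx S) b, diagPart (blockIdx S) (b⁻¹ : GL (Fin n) ℝ),
      diagPart_mul_inv_of_mem hb, mul_eq_one_comm.1 (diagPart_mul_inv_of_mem hb)⟩, ?_, rfl⟩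
    exact mem_rotTorus_iff.2 ⟨h1, fun i hi => by simpa [diagPart] using h2 i hi⟩

/-- Diagonalizable and unipotent: every eigenvalue minus 1 is a nilpotent complex number, hence
zero. -/
theorem IsRotDiag.eq_one_of_isNilpotent (hσ : ∀ i, σ (σ i) = i)
    {M : Matrix (Fin n) (Fin n) ℝ} (hM : IsRotDiag σ M) (h : IsNilpotent (M - 1)) : M = 1 := by
  obtain ⟨k, hk⟩ := h
  have h1 := hM.hasEigenvalues hσ
  have h2 := (h1.add (HasEigenvalues.one.smul (-1))).pow k
  have h3 : (M.map Complex.ofReal + (-1 : ℂ) • (1 : Matrix (Fin n) (Fin n) ℂ)) ^ k = 0 := by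
    have := congrArg Complex.ofRealHom.mapMatrix hk
    rw [map_pow, map_sub, map_one, map_zero] at this
    rw [neg_one_smul, ← sub_eq_add_neg]
    exact this
  rw [h3] at h2
  have h4 : HasEigenvalues σ 0 0 := by simp [HasEigenvalues]
  have h5 : rotEigenvalues σ M = 1 := by
    ext i
    have h6 := congrFun (h2.unique hσ h4) i
    have h7 := eq_zero_of_pow_eq_zero (show (rotEigenvalues σ M i + (-1) • 1) ^ k = 0 by
      simpa using h6)
    simpa [add_neg_eq_zero] using h7
  rw [h5] at h1
  apply map_ofReal_injective
  change M.map Complex.ofReal = Complex.ofRealHom.mapMatrix 1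
  rw [map_one, h1.eq hσ, ← HasEigenvalues.one.eq hσ]

theorem isRotDiag_one : IsRotDiag σ 1 :=
  ⟨fun i j h _ => one_apply_ne (Ne.symm h), fun i => by simp,
    fun i hi => by simp [one_apply_ne hi, one_apply_ne (Ne.symm hi)]⟩

theorem blockTriangular_sub_one {g : GL (Fin n) ℝ} (hg : g ∈ stdParabolic S) :
    BlockTriangular ((g : Matrix (Fin n) (Fin n) ℝ) - 1) (blockIdx S) :=
  BlockTriangular.sub hg blockTriangular_one

theorem mem_blockUnipotent_iff_isUnipotentElt (h : IsPairing (blockIdx S) σ) {b : GL (Fin n) ℝ} :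
    b ∈ blockUnipotent S ↔ b ∈ rotBorel h ∧ IsUnipotentElt b := by
  constructor
  · intro hb
    refine ⟨mem_rotBorel_iff.2 ⟨hb.1, ?_, fun i _ => ?_⟩, isUnipotentElt_of_mem_blockUnipotent hb⟩
    · rw [hb.2]
      exact isRotDiag_one
    · rw [mem_blockUnipotent_iff.1 hb i i le_rfl]
      simp
  · rintro ⟨hb, hu⟩
    have hb' := mem_rotBorel_iff.1 hb
    refine ⟨hb.1, hb'.2.1.eq_one_of_isNilpotent h.invol ?_⟩
    rw [← diagPart_one (blockIdx S), ← diagPart_sub]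
    exact isNilpotent_diagPart (blockTriangular_sub_one hb.1) hu

/-- The `2 × 2` block of a matrix at the indices `i` and `σ i`. -/
def pairBlock (σ : Fin n → Fin n) (i : Fin n) (M : Matrix (Fin n) (Fin n) ℝ) :
    Matrix (Fin 2) (Fin 2) ℝ :=
  M.submatrix ![i, σ i] ![i, σ i]

/-- The rows `i` and `σ i` of a block diagonal matrix are supported on that pair. Only the left
factor need be block diagonal, so products can be peeled from the left. -/
theorem pairBlock_diagPart_mul {β : Fin n → ℕ} (h : IsPairing β σ) {i : Fin n} (hi : σ i ≠ i)
    (M N : Matrix (Fin n) (Fin n) ℝ) :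
    pairBlock σ i (diagPart β M * N) = pairBlock σ i (diagPart β M) * pairBlock σ i N := by
  have key : ∀ a ∈ ({i, σ i} : Set (Fin n)), ∀ b, (diagPart β M * N) a b =
      diagPart β M a i * N i b + diagPart β M a (σ i) * N (σ i) b := by
    intro a ha b
    have hβ : β a = β i := by
      rcases ha with rfl | rfl
      · rfl
      · exact (h.apply_eq i).symm
    rw [mul_apply, sum_eq_of_forall_eq_zero (σ := σ) (i := i), if_neg hi]
    intro j h1 h2
    have : β a ≠ β j := by
      rw [hβ, Ne, h.eq_iff]
      tauto
    simp [diagPart, this]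
  ext a b
  rw [mul_apply, Fin.sum_univ_two]
  fin_cases a
  · exact key i (by simp) _
  · exact key (σ i) (by simp) _

theorem pairBlock_one {i : Fin n} (hi : σ i ≠ i) : pairBlock σ i 1 = 1 := by
  ext a b
  fin_cases a <;> fin_cases b
  · exact one_apply_eq i
  · exact one_apply_ne (Ne.symm hi)
  · exact one_apply_ne hi
  · exact one_apply_eq (σ i)

theorem isNilpotent_pairBlock {β : Fin n → ℕ} (h : IsPairing β σ) {i : Fin n} (hi : σ i ≠ i)
    {M : Matrix (Fin n) (Fin n) ℝ} (hM : BlockTriangular M β) (hN : IsNilpotent M) :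
    IsNilpotent (pairBlock σ i (diagPart β M)) := by
  obtain ⟨k, hk⟩ := isNilpotent_diagPart hM hN
  have key : ∀ k, pairBlock σ i (diagPart β M ^ k) = pairBlock σ i (diagPart β M) ^ k := by
    intro k
    induction k with
    | zero => simpa using pairBlock_one hi
    | succ k ih => rw [pow_succ', pow_succ', ← ih, pairBlock_diagPart_mul h hi]
  refine ⟨k, ?_⟩
  rw [← key, hk]
  rfl

/-- For `A = (a, b; c, d)` one has `J * A * J' = (d, -c; -b, a)`, so the trace condition reads `2ad
- b² - c² = 2`. Unipotence gives `a + d = 2`, and substitution leaves `2(a - 1)² + b² + c² = 0`. -/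
theorem eq_one_of_isNilpotent_of_trace {A J J' : Matrix (Fin 2) (Fin 2) ℝ}
    (hJ : J = !![0, 1; -1, 0]) (hJJ : J * J' = 1) (hA : IsNilpotent (A - 1))
    (h : (A * (J * (A * J'))).trace = 2) : A = 1 := by
  have hJ' : J' = !![0, -1; 1, 0] := by
    have : (!![0, -1; 1, 0] : Matrix (Fin 2) (Fin 2) ℝ) * J = 1 := by
      rw [hJ]
      ext a b
      fin_cases a <;> fin_cases b <;> simp
    rw [← Matrix.one_mul J', ← this, Matrix.mul_assoc, hJJ, Matrix.mul_one]
  have htr : A 0 0 + A 1 1 - 2 = 0 := by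
    simpa [trace_fin_two] using (isNilpotent_trace_of_isNilpotent hA).eq_zero
  have hdet : (A 0 0 - 1) * (A 1 1 - 1) - A 0 1 * A 1 0 = 0 := by
    obtain ⟨k, hk⟩ := hA
    have : (A - 1).det = 0 := eq_zero_of_pow_eq_zero (n := k) (by
      rw [← det_pow, hk, det_zero])
    simpa [det_fin_two] using this
  have h2 : A 0 0 * A 1 1 + A 0 1 * -A 0 1 + (A 1 0 * -A 1 0 + A 1 1 * A 0 0) = 2 := by
    rw [hJ, hJ'] at h
    simp only [trace_fin_two, mul_apply, Fin.sum_univ_two] at h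
    simpa using h
  have hs : (A 0 0 - 1) ^ 2 * 2 + A 0 1 ^ 2 + A 1 0 ^ 2 = 0 := by
    have : A 1 1 = 2 - A 0 0 := by linarith
    rw [this] at h2
    linarith
  have h00 : A 0 0 = 1 := by nlinarith [sq_nonneg (A 0 0 - 1), sq_nonneg (A 0 1), sq_nonneg (A 1 0)]
  have h01 : A 0 1 = 0 := by nlinarith [sq_nonneg (A 0 0 - 1), sq_nonneg (A 0 1), sq_nonneg (A 1 0)]
  have h10 : A 1 0 = 0 := by nlinarith [sq_nonneg (A 0 0 - 1), sq_nonneg (A 0 1), sq_nonneg (A 1 0)]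
  ext a b
  fin_cases a <;> fin_cases b <;> simp [h00, h01, h10]
  linarith

theorem exists_quarterTurn (hσ : ∀ i, σ (σ i) = i) {i : Fin n} (hi : σ i ≠ i) :
    ∃ c ∈ rotTorus σ hσ, pairBlock σ i (c : Matrix (Fin n) (Fin n) ℝ) = !![0, 1; -1, 0] := by
  -- A quarter turn has eigenvalues `±i` on the chosen pair; all other blocks are trivial.
  let z : Fin n → ℂ := fun j => if j = i then Complex.I else if j = σ i then -Complex.I else 1
  have hz : IsAdmissible σ z := by
    have hinj : Function.Injective σ := Function.LeftInverse.injective hσ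
    refine ⟨fun j => ?_, fun j => ?_, fun j hj => ?_⟩
    · by_cases h1 : j = i
      · simp [z, h1, hi]
      · by_cases h2 : j = σ i
        · simp [z, h2, hσ, hi]
        · have h3 : σ j ≠ i := fun h => h2 (by rw [← h, hσ])
          have h4 : σ j ≠ σ i := hinj.ne h1
          simp [z, h1, h2, h3, h4]
    · simp only [z]
      split_ifs <;> simp
    · have h1 : j ≠ i := fun h => hi (h ▸ hj)
      have h2 : j ≠ σ i := fun h => hi (by rw [← h, ← hj, h, hσ])
      simp [z, h1, h2]
  obtain ⟨c, hc, hcz⟩ := exists_mem_rotTorus (hσ := hσ) hz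
  refine ⟨c, hc, ?_⟩
  rw [hcz]
  ext a b
  fin_cases a <;> fin_cases b <;> simp [pairBlock, rotMatrix, z, hσ, hi, Ne.symm hi]

/-- Normality puts `g * (c * g * c⁻¹)` in `N` for a quarter turn `c`. Its unipotence gives the trace
condition of `eq_one_of_isNilpotent_of_trace` on each `2 × 2` block. -/
theorem le_blockUnipotent (h : IsPairing (blockIdx S) σ) {N : Subgroup (GL (Fin n) ℝ)}
    (hNP : N ≤ stdParabolic S) (hN : (N.subgroupOf (stdParabolic S)).Normal)
    (hu : ∀ g ∈ N, IsUnipotentElt g) : N ≤ blockUnipotent S := by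
  have hconj : ∀ p ∈ stdParabolic S, ∀ g ∈ N, p * g * p⁻¹ ∈ N := fun p hp g hg =>
    Subgroup.mem_subgroupOf.1 (hN.conj_mem ⟨g, hNP hg⟩ (Subgroup.mem_subgroupOf.2 hg) ⟨p, hp⟩)
  have hnil : ∀ i, σ i ≠ i → ∀ g ∈ N,
      IsNilpotent (pairBlock σ i (diagPart (blockIdx S) (g : Matrix (Fin n) (Fin n) ℝ)) - 1) := by
    intro i hi g hg
    have h1 := isNilpotent_pairBlock h hi (blockTriangular_sub_one (hNP hg)) (hu g hg)
    rw [diagPart_sub, diagPart_one] at h1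
    rw [← pairBlock_one hi]
    exact h1
  have hpair : ∀ i, σ i ≠ i → ∀ g ∈ N,
      pairBlock σ i (diagPart (blockIdx S) (g : Matrix (Fin n) (Fin n) ℝ)) = 1 := by
    intro i hi g hg
    obtain ⟨c, hc, hcJ⟩ := exists_quarterTurn h.invol hi
    have hcP := rotTorus_le_stdParabolic h hc
    have hcd := diagPart_eq_self_of_mem_rotTorus h hc
    have hid := diagPart_eq_self_of_mem_rotTorus h (inv_mem hc)
    have hgP := hNP hg
    refine eq_one_of_isNilpotent_of_trace (J' := pairBlock σ i (c⁻¹ : GL (Fin n) ℝ)) hcJ ?_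
      (hnil i hi g hg) ?_
    · nth_rw 1 [← hcd]
      rw [← pairBlock_diagPart_mul h hi, hcd, ← Units.val_mul, mul_inv_cancel, Units.val_one,
        pairBlock_one hi]
    · have h1 : g * (c * (g * c⁻¹)) ∈ N := by
        have := mul_mem hg (hconj c hcP g hg)
        rwa [mul_assoc c] at this
      have h2 := (isNilpotent_trace_of_isNilpotent (hnil i hi _ h1)).eq_zero
      rw [diagPart_mul_of_mem hgP (mul_mem hcP (mul_mem hgP (inv_mem hcP))),
        diagPart_mul_of_mem hcP (mul_mem hgP (inv_mem hcP)),
        diagPart_mul_of_mem hgP (inv_mem hcP), pairBlock_diagPart_mul h hi,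
        pairBlock_diagPart_mul h hi, pairBlock_diagPart_mul h hi, hid, hcd, trace_sub,
        trace_one, sub_eq_zero] at h2
      simpa using h2
  intro g hg
  -- Once the `2 × 2` blocks are trivial, the block diagonal part satisfies `IsRotDiag`, and
  -- unipotence settles the `1 × 1` blocks as well.
  refine ⟨hNP hg, IsRotDiag.eq_one_of_isNilpotent h.invol ⟨fun i j h1 h2 => ?_, fun i => ?_,
    fun i hi => ?_⟩ ?_⟩
  · have : blockIdx S i ≠ blockIdx S j := by
      rw [Ne, h.eq_iff]
      tauto
    simp [diagPart, this]
  · by_cases hi : σ i = i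
    · rw [hi]
    · have h1 := congrFun (congrFun (hpair i hi g hg) 0) 0
      have h2 := congrFun (congrFun (hpair i hi g hg) 1) 1
      exact h2.trans h1.symm
  · have h1 : diagPart (blockIdx S) (g : Matrix (Fin n) (Fin n) ℝ) i (σ i) = 0 :=
      congrFun (congrFun (hpair i hi g hg) 0) 1
    have h2 : diagPart (blockIdx S) (g : Matrix (Fin n) (Fin n) ℝ) (σ i) i = 0 :=
      congrFun (congrFun (hpair i hi g hg) 1) 0
    rw [h1, h2, neg_zero]
  · rw [← diagPart_one (blockIdx S), ← diagPart_sub]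
    exact isNilpotent_diagPart (blockTriangular_sub_one (hNP hg)) (hu g hg)

theorem isUnipotentRadical_blockUnipotent (h : IsPairing (blockIdx S) σ) :
    IsUnipotentRadical (blockUnipotent S) (stdParabolic S) := by
  refine ⟨⟨fun g hg => hg.1, ⟨fun g hg p => ?_⟩, isZariskiClosed_blockUnipotent,
    isConnected_blockUnipotent, fun g hg => isUnipotentElt_of_mem_blockUnipotent hg⟩, ?_⟩
  · exact Subgroup.mem_subgroupOf.2
      (conj_mem_blockUnipotent p.2 (Subgroup.mem_subgroupOf.1 hg))
  · rintro N ⟨h1, h2, -, -, h3⟩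
    exact le_blockUnipotent h h1 h2 h3

theorem rotTorus_le_rotBorel (h : IsPairing (blockIdx S) σ) : rotTorus σ h.invol ≤ rotBorel h :=
  fun c hc => ⟨rotTorus_le_stdParabolic h hc, c, hc, diagPart_eq_self_of_mem_rotTorus h hc⟩

theorem normal_blockUnipotent_subgroupOf (h : IsPairing (blockIdx S) σ) :
    ((blockUnipotent S).subgroupOf (rotBorel h)).Normal :=
  ⟨fun _ hg p => Subgroup.mem_subgroupOf.2
    (conj_mem_blockUnipotent p.2.1 (Subgroup.mem_subgroupOf.1 hg))⟩

theorem isComplement'_blockUnipotent_rotTorus (h : IsPairing (blockIdx S) σ) :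
    Subgroup.IsComplement' ((blockUnipotent S).subgroupOf (rotBorel h))
      ((rotTorus σ h.invol).subgroupOf (rotBorel h)) := by
  refine Subgroup.isComplement'_of_disjoint_and_mul_eq_univ ?_ ?_
  · rw [Subgroup.disjoint_def]
    intro x hx hx'
    rw [Subgroup.mem_subgroupOf] at hx hx'
    apply Subtype.ext
    apply Units.ext
    rw [← diagPart_eq_self_of_mem_rotTorus h hx', hx.2]
    rfl
  · rw [Set.eq_univ_iff_forall]
    rintro ⟨b, hb⟩
    obtain ⟨hbP, c, hc, hbc⟩ := id hb
    have hcP := rotTorus_le_stdParabolic h hc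
    -- Dividing `b` by its block diagonal part `c` leaves a block unipotent matrix.
    refine ⟨⟨b * c⁻¹, mul_mem hb (inv_mem (rotTorus_le_rotBorel h hc))⟩, ?_,
      ⟨c, rotTorus_le_rotBorel h hc⟩, Subgroup.mem_subgroupOf.2 hc, Subtype.ext (by simp)⟩
    refine Subgroup.mem_subgroupOf.2 ⟨mul_mem hbP (inv_mem hcP), ?_⟩
    rw [diagPart_mul_of_mem hbP (inv_mem hcP), hbc,
      diagPart_eq_self_of_mem_rotTorus h (inv_mem hc), ← Units.val_mul, mul_inv_cancel,
      Units.val_one]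

end RealAlg

end

/-! ### From sets of simple roots to pairings of indices. -/

noncomputable section

namespace RealAlg

variable {n : ℕ} {S : Finset (Fin (n - 1))}

theorem blockIdx_mono (S : Finset (Fin (n - 1))) : Monotone (blockIdx S) := by
  intro i j hij
  refine Finset.card_le_card fun k => ?_
  simp only [Finset.mem_filter, Finset.mem_univ, true_and]
  exact fun h => ⟨h.1.trans_le hij, h.2⟩

/-- `blockIdx` counts the block boundaries before an index, so equality means that no boundary lies
in between. -/
theorem blockIdx_eq_iff_of_lt {i j : Fin n} (hij : i < j) :
    blockIdx S i = blockIdx S j ↔ ∀ k : Fin (n - 1), (i : ℕ) ≤ k → (k : ℕ) < j → k ∈ S := by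
  constructor
  · intro h k hik hkj
    by_contra hk
    refine h.not_lt (Finset.card_lt_card ?_)
    refine Finset.ssubset_iff_of_subset (fun l => ?_) |>.2 ⟨k, ?_, ?_⟩
    · simp only [Finset.mem_filter, Finset.mem_univ, true_and]
      exact fun h => ⟨h.1.trans hij, h.2⟩
    · simpa using ⟨hkj, hk⟩
    · simp [hik]
  · intro h
    refine congrArg Finset.card (Finset.filter_congr fun k _ => ?_)
    constructor
    · exact fun hk => ⟨hk.1.trans hij, hk.2⟩
    · exact fun hk => ⟨lt_of_not_ge fun hik => hk.2 (h k hik hk.1), hk.2⟩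

/-- The hypothesis `hS`, that no two roots in `S` are adjacent, is the combinatorial form of
orthogonality. A block with three indices would require two adjacent roots. -/
theorem blockIdx_eq_iff_exists_of_lt (hS : ∀ k ∈ S, ∀ l ∈ S, (l : ℕ) ≠ k + 1) {i j : Fin n}
    (hij : i < j) : blockIdx S i = blockIdx S j ↔ ∃ k ∈ S, i = lo k ∧ j = hi k := by
  rw [blockIdx_eq_iff_of_lt hij]
  have hij' : (i : ℕ) < j := hij
  have hj := j.2
  constructor
  · intro h
    have h1 : (⟨i, by omega⟩ : Fin (n - 1)) ∈ S := h _ le_rfl hij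
    refine ⟨_, h1, rfl, Fin.ext ?_⟩
    simp only [hi]
    by_contra hne
    exact hS _ h1 ⟨i + 1, by omega⟩ (h _ (by simp) (by simp only; omega)) rfl
  · rintro ⟨k, hk, rfl, rfl⟩ l h1 h2
    simp only [lo, hi] at h1 h2
    obtain rfl : l = k := Fin.ext (by omega)
    exact hk

open Classical in
/-- The other member of the block of `i`, or `i` itself if the block is a singleton. -/
def partner (S : Finset (Fin (n - 1))) (i : Fin n) : Fin n :=
  if h : ∃ k ∈ S, i = lo k then hi h.choose
  else if h : ∃ k ∈ S, i = hi k then lo h.choose else i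

theorem lo_injective : Function.Injective (lo : Fin (n - 1) → Fin n) := fun k l h =>
  Fin.ext (by simpa [lo] using h)

theorem hi_injective : Function.Injective (hi : Fin (n - 1) → Fin n) := fun k l h =>
  Fin.ext (by simpa [hi] using h)

theorem lo_lt_hi (k : Fin (n - 1)) : lo k < hi k := by
  simp [lo, hi, Fin.lt_def]

theorem hi_ne_lo (hS : ∀ k ∈ S, ∀ l ∈ S, (l : ℕ) ≠ k + 1) {k l : Fin (n - 1)} (hk : k ∈ S)
    (hl : l ∈ S) : hi k ≠ lo l := fun h =>
  hS k hk l hl (by simpa [lo, hi] using (congrArg Fin.val h).symm)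

theorem partner_lo {k : Fin (n - 1)} (hk : k ∈ S) : partner S (lo k) = hi k := by
  have h : ∃ l ∈ S, lo k = lo l := ⟨k, hk, rfl⟩
  rw [partner, dif_pos h, lo_injective h.choose_spec.2.symm]

theorem partner_hi (hS : ∀ k ∈ S, ∀ l ∈ S, (l : ℕ) ≠ k + 1) {k : Fin (n - 1)} (hk : k ∈ S) :
    partner S (hi k) = lo k := by
  have h : ∃ l ∈ S, hi k = hi l := ⟨k, hk, rfl⟩
  have h' : ¬ ∃ l ∈ S, hi k = lo l := fun ⟨l, hl, h⟩ => hi_ne_lo hS hk hl h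
  rw [partner, dif_neg h', dif_pos h, hi_injective h.choose_spec.2.symm]

theorem partner_eq_self {i : Fin n} (h : ∀ k ∈ S, i ≠ lo k ∧ i ≠ hi k) : partner S i = i := by
  rw [partner, dif_neg, dif_neg]
  · rintro ⟨k, hk, h'⟩
    exact (h k hk).2 h'
  · rintro ⟨k, hk, h'⟩
    exact (h k hk).1 h'

theorem eq_lo_or_eq_hi_or (S : Finset (Fin (n - 1))) (i : Fin n) :
    (∃ k ∈ S, i = lo k) ∨ (∃ k ∈ S, i = hi k) ∨ ∀ k ∈ S, i ≠ lo k ∧ i ≠ hi k := by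
  by_cases h1 : ∃ k ∈ S, i = lo k
  · exact Or.inl h1
  · by_cases h2 : ∃ k ∈ S, i = hi k
    · exact Or.inr (Or.inl h2)
    · push Not at h1 h2
      exact Or.inr (Or.inr fun k hk => ⟨h1 k hk, h2 k hk⟩)

theorem isPairing_partner (hS : ∀ k ∈ S, ∀ l ∈ S, (l : ℕ) ≠ k + 1) :
    IsPairing (blockIdx S) (partner S) := by
  have hblock : ∀ k ∈ S, blockIdx S (lo k) = blockIdx S (hi k) := fun k hk =>
    (blockIdx_eq_iff_exists_of_lt hS (lo_lt_hi k)).2 ⟨k, hk, rfl, rfl⟩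
  constructor
  · intro i
    rcases eq_lo_or_eq_hi_or S i with ⟨k, hk, rfl⟩ | ⟨k, hk, rfl⟩ | h
    · rw [partner_lo hk, partner_hi hS hk]
    · rw [partner_hi hS hk, partner_lo hk]
    · rw [partner_eq_self h, partner_eq_self h]
  · intro i j
    constructor
    · intro h
      rcases lt_trichotomy i j with hij | rfl | hij
      · obtain ⟨k, hk, rfl, rfl⟩ := (blockIdx_eq_iff_exists_of_lt hS hij).1 h
        exact Or.inr (partner_lo hk).symm
      · exact Or.inl rfl
      · obtain ⟨k, hk, rfl, rfl⟩ := (blockIdx_eq_iff_exists_of_lt hS hij).1 h.symm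
        exact Or.inr (partner_hi hS hk).symm
    · rintro (rfl | rfl)
      · rfl
      · rcases eq_lo_or_eq_hi_or S i with ⟨k, hk, rfl⟩ | ⟨k, hk, rfl⟩ | h
        · rw [partner_lo hk, hblock k hk]
        · rw [partner_hi hS hk, hblock k hk]
        · rw [partner_eq_self h]

theorem mutuallyOrthogonal_of_forall_ne (hS : ∀ k ∈ S, ∀ l ∈ S, (l : ℕ) ≠ k + 1) :
    MutuallyOrthogonal S := by
  intro k hk l hl hkl
  have h1 : lo k ≠ lo l := lo_injective.ne hkl
  have h2 : hi k ≠ hi l := hi_injective.ne hkl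
  have h3 := hi_ne_lo hS hk hl
  have h4 := (hi_ne_lo hS hl hk).symm
  simp [simpleRoot, h1, h2, h3, h4]

theorem hasRotationScalingBlocks_iff (hS : ∀ k ∈ S, ∀ l ∈ S, (l : ℕ) ≠ k + 1)
    {g : GL (Fin n) ℝ} : HasRotationScalingBlocks S g ↔
      IsRotDiag (partner S) (diagPart (blockIdx S) (g : Matrix (Fin n) (Fin n) ℝ)) ∧
      ∀ i, partner S i = i → 0 < (g : Matrix (Fin n) (Fin n) ℝ) i i := by
  have h := isPairing_partner hS
  have hii : ∀ i, diagPart (blockIdx S) (g : Matrix (Fin n) (Fin n) ℝ) i i = g.1 i i := fun i =>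
    diagPart_apply_of_eq rfl
  have hblock : ∀ k ∈ S, blockIdx S (lo k) = blockIdx S (hi k) := fun k hk => by
    rw [h.apply_eq, partner_lo hk]
  have hlh : ∀ k ∈ S, diagPart (blockIdx S) (g : Matrix (Fin n) (Fin n) ℝ) (lo k) (hi k) =
      g.1 (lo k) (hi k) := fun k hk => diagPart_apply_of_eq (hblock k hk)
  have hhl : ∀ k ∈ S, diagPart (blockIdx S) (g : Matrix (Fin n) (Fin n) ℝ) (hi k) (lo k) =
      g.1 (hi k) (lo k) := fun k hk => diagPart_apply_of_eq (hblock k hk).symm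
  constructor
  · rintro ⟨hpos, hrot⟩
    refine ⟨⟨fun i j h1 h2 => ?_, fun i => ?_, fun i hi' => ?_⟩, fun i hi' => hpos i ?_⟩
    · have : blockIdx S i ≠ blockIdx S j := by
        rw [Ne, h.eq_iff]
        tauto
      simp [diagPart, this]
    · rw [hii, hii]
      rcases eq_lo_or_eq_hi_or S i with ⟨k, hk, rfl⟩ | ⟨k, hk, rfl⟩ | h
      · rw [partner_lo hk, (hrot k hk).1]
      · rw [partner_hi hS hk, (hrot k hk).1]
      · rw [partner_eq_self h]
    · rcases eq_lo_or_eq_hi_or S i with ⟨k, hk, rfl⟩ | ⟨k, hk, rfl⟩ | h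
      · rw [partner_lo hk, hlh k hk, hhl k hk, (hrot k hk).2]
      · rw [partner_hi hS hk, hlh k hk, hhl k hk, (hrot k hk).2, neg_neg]
      · exact absurd (partner_eq_self h) hi'
    · refine fun k hk => ⟨?_, ?_⟩ <;> rintro rfl
      · exact (lo_lt_hi k).ne (hi'.symm.trans (partner_lo hk))
      · exact (lo_lt_hi k).ne ((partner_hi hS hk).symm.trans hi')
  · rintro ⟨hrot, hpos⟩
    refine ⟨fun i hi' => hpos i (partner_eq_self hi'), fun k hk => ?_⟩
    have h1 := hrot.diag (lo k)
    have h2 := hrot.anti (lo k) (by rw [partner_lo hk]; exact (lo_lt_hi k).ne')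
    rw [partner_lo hk] at h1 h2
    rw [hii, hii] at h1
    rw [hlh k hk, hhl k hk] at h2
    exact ⟨h1, h2⟩

theorem mem_rotTorus_partner_iff (hS : ∀ k ∈ S, ∀ l ∈ S, (l : ℕ) ≠ k + 1) {c : GL (Fin n) ℝ} :
    c ∈ rotTorus (partner S) (isPairing_partner hS).invol ↔
      IsBlockDiag S c ∧ HasRotationScalingBlocks S c := by
  have h := isPairing_partner hS
  rw [hasRotationScalingBlocks_iff hS, mem_rotTorus_iff]
  constructor
  · rintro ⟨h1, h2⟩
    have hd := diagPart_eq_self_of_mem_rotTorus h (mem_rotTorus_iff.2 ⟨h1, h2⟩)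
    refine ⟨fun i j hij => ?_, hd.symm ▸ h1, h2⟩
    rw [← hd]
    simp [diagPart, hij]
  · rintro ⟨h0, h1, h2⟩
    have hd : diagPart (blockIdx S) (c : Matrix (Fin n) (Fin n) ℝ) = c := by
      ext i j
      by_cases hij : blockIdx S i = blockIdx S j
      · exact diagPart_apply_of_eq hij
      · simp [diagPart, hij, h0 i j hij]
    exact ⟨hd ▸ h1, h2⟩

open Classical in
theorem exists_finset_of_isRotTriangular {T : Set ℕ} (hT : ∀ k ∈ T, k + 1 ∉ T ∧ k + 1 < n) :
    ∃ S : Finset (Fin (n - 1)), (∀ k ∈ S, ∀ l ∈ S, (l : ℕ) ≠ k + 1) ∧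
      ∀ g : GL (Fin n) ℝ, IsRotTriangular T (g : Matrix (Fin n) (Fin n) ℝ) →
        g ∈ stdParabolic S ∧ HasRotationScalingBlocks S g := by
  set S : Finset (Fin (n - 1)) := Finset.univ.filter fun k => (k : ℕ) ∈ T with hSdef
  have hmem : ∀ k, k ∈ S ↔ (k : ℕ) ∈ T := fun k => by simp [hSdef]
  have hS : ∀ k ∈ S, ∀ l ∈ S, (l : ℕ) ≠ k + 1 := by
    intro k hk l hl h
    rw [hmem] at hk hl
    exact (hT k hk).1 (h ▸ hl)
  refine ⟨S, hS, fun g hg => ⟨fun i j hij => ?_, fun i hi' => ?_, fun k hk => ?_⟩⟩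
  · have hji : j < i := lt_of_not_ge fun hle => (blockIdx_mono S hle).not_gt hij
    refine hg.lower i j hji fun h => ?_
    refine (ne_of_lt hij) ((blockIdx_eq_iff_exists_of_lt hS hji).2 ?_)
    have := i.2
    exact ⟨⟨j, by omega⟩, (hmem _).2 h.2, rfl, Fin.ext h.1⟩
  · have := i.2
    refine hg.pos i (fun h => ?_) fun k hk h => ?_
    · have := (hT _ h).2
      exact (hi' ⟨i, by omega⟩ ((hmem _).2 h)).1 rfl
    · exact (hi' ⟨k, by omega⟩ ((hmem _).2 hk)).2 (Fin.ext h)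
  · exact hg.rot (lo k) (hi k) rfl ((hmem k).1 hk)

/-! ### Conjugating a connected solvable group into `B`. -/

theorem continuous_exp_smul (X : Matrix (Fin n) (Fin n) ℝ) :
    Continuous fun t : ℝ => NormedSpace.exp (t • X) := by
  open scoped Norms.Operator in
  exact NormedSpace.exp_continuous.comp (continuous_id.smul continuous_const)

/-- Each generator `exp X` is joined to 1 inside `G` by the path `exp (t • X)`. -/
theorem IsConnectedLie.isPreconnected {G : Subgroup (GL (Fin n) ℝ)} (hG : IsConnectedLie G) :
    IsPreconnected (G : Set (GL (Fin n) ℝ)) := by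
  rw [IsConnectedLie] at hG
  have key := isPreconnected_closure_of_forall (s := {h : GL (Fin n) ℝ |
    ∃ X ∈ lieAlg G, (h : Matrix (Fin n) (Fin n) ℝ) = NormedSpace.exp X}) (by
    rw [← hG]
    rintro h ⟨X, hX, hh⟩
    choose f hfG hf using hX
    refine ⟨Set.range f, ?_, ⟨0, Units.ext (by simp [hf])⟩, ⟨1, Units.ext (by simp [hf, hh])⟩,
      isPreconnected_range (continuous_generalLinearGroup_iff.2 ?_)⟩
    · rintro _ ⟨t, rfl⟩
      exact hfG t
    · simp only [hf]
      exact continuous_exp_smul X)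
  rwa [← hG] at key

/-- A connected solvable group of real matrices can be conjugated to block triangular form with
positive `1 × 1` blocks and rotation-scaling `2 × 2` blocks. -/
theorem exists_conj_isRotTriangular {G : Subgroup (GL (Fin n) ℝ)}
    (hG : IsPreconnected (G : Set (GL (Fin n) ℝ))) (hsolv : Group.IsSolvable G) :
    ∃ (a : GL (Fin n) ℝ) (T : Set ℕ), (∀ k ∈ T, k + 1 ∉ T ∧ k + 1 < n) ∧
      ∀ g ∈ G, IsRotTriangular T ((a * g * a⁻¹ : GL (Fin n) ℝ) : Matrix (Fin n) (Fin n) ℝ) := by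
  have : PreconnectedSpace G := isPreconnected_iff_preconnectedSpace.1 hG
  let ρ : G →* Module.End ℝ (Fin n → ℝ) :=
    { toFun := fun g => toLin' (g.1 : Matrix (Fin n) (Fin n) ℝ)
      map_one' := by simp [Module.End.one_eq_id]
      map_mul' := fun g h => by
        rw [Subgroup.coe_mul, Units.val_mul, toLin'_mul, Module.End.mul_eq_comp] }
  have hρ : ∀ v (f : Module.Dual ℝ (Fin n → ℝ)), Continuous fun g => f (ρ g v) := by
    intro v f
    refine (LinearMap.continuous_of_finiteDimensional f).comp ?_
    change Continuous fun g : G => (g.1 : Matrix (Fin n) (Fin n) ℝ) *ᵥ v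
    exact (Units.continuous_val.comp continuous_subtype_val).matrix_mulVec continuous_const
  obtain ⟨b, T, hT, h⟩ := exists_basis_isRotTriangular ρ hρ (n := n) (by simp)
  -- The conjugator is the change of basis from the standard basis to the adapted one, so `a * g *
  -- a⁻¹` is the matrix of `g` in the adapted basis.
  refine ⟨⟨b.toMatrix (Pi.basisFun ℝ (Fin n)), (Pi.basisFun ℝ (Fin n)).toMatrix b,
    b.toMatrix_mul_toMatrix_flip _, Module.Basis.toMatrix_mul_toMatrix_flip _ _⟩, T, hT,
    fun g hg => ?_⟩
  convert h ⟨g, hg⟩ using 1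
  rw [← basis_toMatrix_mul_linearMap_toMatrix_mul_basis_toMatrix b (Pi.basisFun ℝ (Fin n)) b
    (Pi.basisFun ℝ (Fin n)), LinearMap.toMatrix_eq_toMatrix']
  change _ = _ * LinearMap.toMatrix' (toLin' (g : Matrix (Fin n) (Fin n) ℝ)) * _
  rw [LinearMap.toMatrix'_toLin']
  rfl

end RealAlg

end

theorem mainTheorem3 (n : ℕ) (G : Subgroup (GL (Fin n) ℝ))
    (hG : RealAlg.IsRealAlgebraic G) (hsolv : Group.IsSolvable G) :
    ∃ (a : GL (Fin n) ℝ) (S : Finset (Fin (n - 1))) (B U C : Subgroup (GL (Fin n) ℝ)),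
      -- `a G a⁻¹` lies in the block triangular group `B`
      G.map (MulAut.conj a).toMonoidHom ≤ B ∧
      RealAlg.MutuallyOrthogonal S ∧
      (∀ b, b ∈ B ↔ b ∈ RealAlg.stdParabolic S ∧ RealAlg.HasRotationScalingBlocks S b) ∧
      -- the unipotent part of `B` is the unipotent radical of the parabolic
      RealAlg.IsUnipotentRadical U (RealAlg.stdParabolic S) ∧
      (∀ b, b ∈ U ↔ b ∈ B ∧ RealAlg.IsUnipotentElt b) ∧
      -- the semisimple part of `B` is a Cartan subgroup of the parabolic
      RealAlg.IsCartanSubgroup C (RealAlg.stdParabolic S) ∧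
      (∀ c, c ∈ C ↔ RealAlg.IsBlockDiag S c ∧ RealAlg.HasRotationScalingBlocks S c) ∧
      C ≤ B ∧ (∀ c ∈ C, RealAlg.IsSemisimpleElt c) ∧
      -- `B` is the semidirect product of `U` and `C`
      (U.subgroupOf B).Normal ∧ Subgroup.IsComplement' (U.subgroupOf B) (C.subgroupOf B) := by
  obtain ⟨a, T, hT, ha⟩ := RealAlg.exists_conj_isRotTriangular hG.1.isPreconnected hsolv
  obtain ⟨S, hS, hST⟩ := RealAlg.exists_finset_of_isRotTriangular hT
  have h := RealAlg.isPairing_partner hS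
  have hB : ∀ b, b ∈ RealAlg.rotBorel h ↔
      b ∈ RealAlg.stdParabolic S ∧ RealAlg.HasRotationScalingBlocks S b := fun b => by
    rw [RealAlg.mem_rotBorel_iff, RealAlg.hasRotationScalingBlocks_iff hS]
  refine ⟨a, S, RealAlg.rotBorel h, RealAlg.blockUnipotent S,
    RealAlg.rotTorus (RealAlg.partner S) h.invol, ?_, RealAlg.mutuallyOrthogonal_of_forall_ne hS,
    hB, RealAlg.isUnipotentRadical_blockUnipotent h,
    fun b => RealAlg.mem_blockUnipotent_iff_isUnipotentElt h,
    RealAlg.isCartanSubgroup_rotTorus (RealAlg.rotTorus_le_stdParabolic h),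
    fun c => RealAlg.mem_rotTorus_partner_iff hS, RealAlg.rotTorus_le_rotBorel h,
    fun c hc => RealAlg.isSemisimpleElt_of_mem_rotTorus hc,
    RealAlg.normal_blockUnipotent_subgroupOf h, RealAlg.isComplement'_blockUnipotent_rotTorus h⟩
  rintro _ ⟨g, hg, rfl⟩
  exact (hB _).2 (hST _ (ha g hg))
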